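/- **Setting.** Let $A$ be a finite alphabet. A one-dimensional PCA $F$ with alphabet $A$ and neighbourhood $\{0,1\}$ is given by a stochastic matrix $\varphi:A^2\times A\to[0,1]$: from a configuration $\eta\in A^{\mathbb Z}$, every cell $x\in\mathbb Z$ is updated, independently of the other cells, to state $b\in A$ with probability $\varphi(\eta(x),\eta(x+1),b)$. For a probability measure $\mu$ on $A^{\mathbb Z}$ (with the product $\sigma$-field) let $F\mu$ be the law after one update of a random configuration with law $\mu$. The measure $\mu$ is *stationary* if $F\mu=\mu$, and $F$ is *ergodic* if it has a unique stationary probability measure $\mu$ and $F^t\nu\to\mu$ weakly as $t\to\infty$ for every probability measure $\nu$ on $A^{\mathbb Z}$. For $(p,q,r)\in\Theta=\{(p,q,r)\in[0,1]^3: p+q+r>0,\ p+q\le 1\}$ let $\widehat G_{p,q,r}$ be the PCA with alphabet $\{W,L,D\}$ whose matrix $\widehat\varphi_{p,q,r}$ is symmetric in its first two arguments and is given by (probabilities of $W$, $L$, $D$ in this order): - $(W,W)$: $p,\ 1-p,\ 0$; - $(W,L)$: $p+(1-p-q)(1-r),\ q+(1-p-q)r,\ 0$; - $(L,L)$: $p+(1-p-q)(1-r^2),\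 q+(1-p-q)r^2,\ 0$; - $(W,D)$: $p,\ q+(1-p-q)r,\ (1-p-q)(1-r)$; - $(L,D)$: $p+(1-p-q)(1-r),\ q+(1-p-q)r^2,\ (1-p-q)r(1-r)$; - $(D,D)$: $p,\ q+(1-p-q)r^2,\ (1-p-q)(1-r^2)$. For $(r',s')\in\Theta'=\{(r',s')\in[0,1]^2: 0<r'+s'\le 1\}$ let $\widehat E_{r',s'}$ be the PCA with alphabet $\{W,L,D\}$ whose matrix is symmetric in its first two arguments and is given by - $(W,W)$: $2s'-s'^2,\ (1-s')^2,\ 0$; - $(W,L)$: $1-r'+r's',\ r'-r's',\ 0$; - $(L,L)$: $1-r'^2,\ r'^2,\ 0$; - $(W,D)$: $2s'-s'^2,\ r'(1-s'),\ (1-s')(1-r'-s')$; - $(L,D)$: $1-r'+r's',\ r'^2,\ r'(1-r'-s')$; - $(D,D)$: $2s'-s'^2,\ r'^2,\ (1-r'-s')(1+r'-s')$. Let $G_{p,q,r}$ and $E_{r',s'}$ be the PCAs with alphabet $\{W,L\}$ obtained by restricting these matrices to $\{W,L\}$; $\widehat G_{p,q,r}$ and $\widehat E_{r',s'}$ are called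 their *envelopes*. **Theorem 3.** (1) There exist $\epsilon_1,\epsilon_2,\epsilon_3\in(0,1)$ such that $G_{p,q,r}$ and its envelope $\widehat G_{p,q,r}$ are both ergodic whenever $(p,q,r)\in\Theta$, $p\le\epsilon_1$, $q\le\epsilon_2$, $r\le\epsilon_3$, $$2(p+q)+6r^2+3r(p+2q)\ \ge\ 4r+(p+q)^2,$$ and at least one of the following holds: - (a) $p(1-p)\le q\{1-q-r(1-p-q)\}$; - (b) $q\{1-q-r(1-p-q)\}<p(1-p)\le\{q+r(1-p-q)\}\{1-q-r(1-p-q)\}$ and $p-2q+pq+qr-3pr-2p^2+3q^2\le 0$; - (c) $q\{1-q-r(1-p-q)\}<p(1-p)\le\{q+r(1-p-q)\}\{1-q-r(1-p-q)\}$, $p-2q+pq+qr-3pr-2p^2+3q^2>0$ and $p+4q+9pr+5qr+6r^2\ge 4r+p^2+4q^2+5pq$; - (d) $q+r(1-p-q)<p$ and $6q+10pr+4qr+p^2+6r^2\ge 4r+6pq+7q^2$. (2) There exist $\epsilon_1,\epsilon_2\in(0,1)$ such that $E_{r',s'}$ and its envelope $\widehat E_{r',s'}$ are both ergodic for every $(r',s')\in\Theta'$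 satisfying at least one of: - (B1) $r'\le\epsilon_1$, $s'\le\epsilon_2$ and $$\frac{3(2s'-s'^2)^2}{2}+\frac{8(2s'-s'^2)r'}{1-s'}+\frac{11r'^2}{2(1-s')^2}\ \ge\ \frac{2r'}{1-s'}+\frac{9(2s'-s'^2)^3}{2}+\frac{16(2s'-s'^2)^2r'}{1-s'}+\frac{43(2s'-s'^2)r'^2}{2(1-s')^2}+\frac{5r'^3}{(1-s')^3};$$ - (B2) $s'=0$ and $r'>0.157175$; - (B3) $r'=s'\ge 0.10883$. -/

import Mathlib

namespace PercPCA

open MeasureTheory ProbabilityTheory Filter Topology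

/-- The alphabet `{W, L}` of an elementary PCA. -/
inductive Letter
  | W
  | L
  deriving DecidableEq

/-- The enlarged alphabet `{W, L, D}` of an envelope PCA. -/
inductive EnvLetter
  | W
  | L
  | D
  deriving DecidableEq

instance : Fintype Letter := ⟨{.W, .L}, by rintro (_ | _) <;> simp⟩

instance : Fintype EnvLetter := ⟨{.W, .L, .D}, by rintro (_ | _ | _) <;> simp⟩

/-- The inclusion `{W, L} ⊆ {W, L, D}`. -/
def Letter.toEnv : Letter → EnvLetter
  | .W => .W
  | .L => .L

instance : MeasurableSpace Letter := ⊤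
instance : DiscreteMeasurableSpace Letter := ⟨fun _ => trivial⟩
instance : TopologicalSpace Letter := ⊥
instance : DiscreteTopology Letter := ⟨rfl⟩
instance : MeasurableSpace EnvLetter := ⊤
instance : DiscreteMeasurableSpace EnvLetter := ⟨fun _ => trivial⟩
instance : TopologicalSpace EnvLetter := ⊥
instance : DiscreteTopology EnvLetter := ⟨rfl⟩

/-- A one-dimensional probabilistic cellular automaton with universe `ℤ`, finite alphabet `A`,
neighbourhood-marking set `{0, 1}` and stochastic update matrix `φ`: a cell `x` whose neighbours
`x`, `x + 1` are in states `a₀`, `a₁` is updated to the state `b` with probability `φ a₀ a₁ b`. -/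
structure PCA (A : Type) [Fintype A] where
  φ : A → A → A → ℝ
  nonneg : ∀ a₀ a₁ b, 0 ≤ φ a₀ a₁ b
  sum_eq_one : ∀ a₀ a₁, ∑ b, φ a₀ a₁ b = 1

namespace PCA

variable {A : Type} [Fintype A] [MeasurableSpace A]

/-- The law on `A` of the updated state of a cell whose neighbours are in states `a₀`, `a₁`. -/
noncomputable def cellLaw (F : PCA A) (a₀ a₁ : A) : Measure A :=
  ∑ b, ENNReal.ofReal (F.φ a₀ a₁ b) • Measure.dirac b

instance (F : PCA A) (a₀ a₁ : A) : IsProbabilityMeasure (F.cellLaw a₀ a₁) := by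
  constructor
  simp only [cellLaw, Measure.coe_finsetSum, Finset.sum_apply, Measure.smul_apply, measure_univ,
    smul_eq_mul, mul_one]
  rw [← ENNReal.ofReal_sum_of_nonneg fun b _ => F.nonneg a₀ a₁ b, F.sum_eq_one]
  simp

/-- The law of `Fη`, for a deterministic configuration `η`: the cells are updated
independently of one another. -/
noncomputable def configLaw (F : PCA A) (η : ℤ → A) : Measure (ℤ → A) :=
  Measure.infinitePi fun x => F.cellLaw (η x) (η (x + 1))

instance (F : PCA A) (η : ℤ → A) : IsProbabilityMeasure (F.configLaw η) := by
  unfold configLaw; infer_instance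

theorem measurable_pair [DiscreteMeasurableSpace A] (f : A × A → ENNReal) (x y : ℤ) :
    Measurable fun η : ℤ → A => f (η x, η y) := by
  have h : Measurable f := measurable_of_countable f
  have g : Measurable fun η : ℤ → A => (η x, η y) := by fun_prop
  exact h.comp g

theorem measurable_cellLaw_apply [DiscreteMeasurableSpace A] (F : PCA A) (x : ℤ) (u : Set A) :
    Measurable fun η : ℤ → A => F.cellLaw (η x) (η (x + 1)) u :=
  measurable_pair (fun z => F.cellLaw z.1 z.2 u) x (x + 1)

theorem measurable_configLaw [DiscreteMeasurableSpace A] (F : PCA A) :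
    Measurable F.configLaw := by
  refine Measurable.measure_of_isPiSystem_of_isProbabilityMeasure
    (S := squareCylinders fun _ : ℤ => {s : Set A | MeasurableSet s})
    generateFrom_squareCylinders.symm ?_ ?_
  · exact isPiSystem_squareCylinders (fun _ => MeasurableSpace.isPiSystem_measurableSet)
      (fun _ => MeasurableSet.univ)
  · rintro _ ⟨s, t, ht, rfl⟩
    have key : ∀ η : ℤ → A, F.configLaw η (Set.pi s t) =
        ∏ x ∈ s, F.cellLaw (η x) (η (x + 1)) (t x) := fun η =>
      Measure.infinitePi_pi _ fun i _ => ht i (Set.mem_univ i)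
    simp only [key]
    exact Finset.measurable_fun_prod s fun x _ => F.measurable_cellLaw_apply x (t x)

/-- The one-step transition kernel of the Markov chain on `A ^ ℤ`. -/
noncomputable def kernel [DiscreteMeasurableSpace A] (F : PCA A) : Kernel (ℤ → A) (ℤ → A) :=
  ⟨F.configLaw, F.measurable_configLaw⟩

instance [DiscreteMeasurableSpace A] (F : PCA A) : IsMarkovKernel F.kernel :=
  ⟨fun η => inferInstanceAs (IsProbabilityMeasure (F.configLaw η))⟩

/-- `Fμ`: the law of the configuration after one update, when the initial configuration is
random with law `μ`. -/
noncomputable def step [DiscreteMeasurableSpace A] (F : PCA A)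
    (μ : ProbabilityMeasure (ℤ → A)) : ProbabilityMeasure (ℤ → A) :=
  ⟨(μ : Measure (ℤ → A)).bind F.kernel, inferInstance⟩

/-- `μ` is stationary for `F` if `Fμ = μ`. -/
def IsStationary [DiscreteMeasurableSpace A] (F : PCA A)
    (μ : ProbabilityMeasure (ℤ → A)) : Prop :=
  F.step μ = μ

/-- `F` is ergodic if it has a unique stationary measure `μ`, and `Fᵗν → μ` weakly as `t → ∞`
for every probability measure `ν` on `A ^ ℤ`. (The topology of `ProbabilityMeasure` is the
topology of weak convergence.) -/
def IsErgodic [DiscreteMeasurableSpace A] [TopologicalSpace A] [DiscreteTopology A]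
    (F : PCA A) : Prop :=
  ∃ μ : ProbabilityMeasure (ℤ → A), F.IsStationary μ ∧
    (∀ ν : ProbabilityMeasure (ℤ → A), F.IsStationary ν → ν = μ) ∧
    ∀ ν : ProbabilityMeasure (ℤ → A), Tendsto (fun t : ℕ => F.step^[t] ν) atTop (𝓝 μ)

end PCA

/-- The parameter space of the generalized percolation game. -/
def Theta : Set (ℝ × ℝ × ℝ) :=
  {θ | θ.1 ∈ Set.Icc 0 1 ∧ θ.2.1 ∈ Set.Icc 0 1 ∧ θ.2.2 ∈ Set.Icc 0 1 ∧
    0 < θ.1 + θ.2.1 + θ.2.2 ∧ θ.1 + θ.2.1 ≤ 1}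

/-- The parameter space of the bond percolation game. -/
def Theta' : Set (ℝ × ℝ) :=
  {θ | θ.1 ∈ Set.Icc 0 1 ∧ θ.2 ∈ Set.Icc 0 1 ∧ 0 < θ.1 + θ.2 ∧ θ.1 + θ.2 ≤ 1}

/-- The stochastic matrix of the envelope of `G p q r`. -/
def gMatrix (p q r : ℝ) : EnvLetter → EnvLetter → EnvLetter → ℝ
  | .W, .W, .W => p
  | .W, .W, .L => 1 - p
  | .W, .W, .D => 0
  | .W, .L, .W | .L, .W, .W => p + (1 - p - q) * (1 - r)
  | .W, .L, .L | .L, .W, .L => q + (1 - p - q) * r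
  | .W, .L, .D | .L, .W, .D => 0
  | .L, .L, .W => p + (1 - p - q) * (1 - r ^ 2)
  | .L, .L, .L => q + (1 - p - q) * r ^ 2
  | .L, .L, .D => 0
  | .W, .D, .W | .D, .W, .W => p
  | .W, .D, .D | .D, .W, .D => (1 - p - q) * (1 - r)
  | .W, .D, .L | .D, .W, .L => (1 - p - q) * r + q
  | .L, .D, .W | .D, .L, .W => p + (1 - p - q) * (1 - r)
  | .L, .D, .D | .D, .L, .D => (1 - p - q) * r * (1 - r)
  | .L, .D, .L | .D, .L, .L => q + (1 - p - q) * r ^ 2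
  | .D, .D, .W => p
  | .D, .D, .D => (1 - p - q) * (1 - r ^ 2)
  | .D, .D, .L => q + (1 - p - q) * r ^ 2

/-- The stochastic matrix of the envelope of `E r s`. -/
def eMatrix (r s : ℝ) : EnvLetter → EnvLetter → EnvLetter → ℝ
  | .W, .W, .W => 2 * s - s ^ 2
  | .W, .W, .L => (1 - s) ^ 2
  | .W, .W, .D => 0
  | .W, .L, .W | .L, .W, .W => 1 - r + r * s
  | .W, .L, .L | .L, .W, .L => r - r * s
  | .W, .L, .D | .L, .W, .D => 0
  | .L, .L, .W => 1 - r ^ 2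
  | .L, .L, .L => r ^ 2
  | .L, .L, .D => 0
  | .W, .D, .D | .D, .W, .D => (1 - s) * (1 - r - s)
  | .W, .D, .L | .D, .W, .L => r * (1 - s)
  | .W, .D, .W | .D, .W, .W => 2 * s - s ^ 2
  | .L, .D, .W | .D, .L, .W => 1 - r + r * s
  | .L, .D, .D | .D, .L, .D => r * (1 - r - s)
  | .L, .D, .L | .D, .L, .L => r ^ 2
  | .D, .D, .D => (1 - r - s) * (1 + r - s)
  | .D, .D, .L => r ^ 2
  | .D, .D, .W => 2 * s - s ^ 2

theorem EnvLetter.sum_eq (f : EnvLetter → ℝ) : ∑ b, f b = f .W + f .L + f .D := by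
  have : (Finset.univ : Finset EnvLetter) = {.W, .L, .D} := rfl
  rw [this, Finset.sum_insert (by decide), Finset.sum_insert (by decide), Finset.sum_singleton]
  ring

theorem Letter.sum_eq (f : Letter → ℝ) : ∑ b, f b = f .W + f .L := by
  have : (Finset.univ : Finset Letter) = {.W, .L} := rfl
  rw [this, Finset.sum_insert (by decide), Finset.sum_singleton]

theorem gMatrix_nonneg {p q r : ℝ} (h : (p, q, r) ∈ Theta) (a₀ a₁ b : EnvLetter) :
    0 ≤ gMatrix p q r a₀ a₁ b := by
  obtain ⟨⟨hp, hp'⟩, ⟨hq, hq'⟩, ⟨hr, hr'⟩, -, hpq⟩ := h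
  simp only at hp hp' hq hq' hr hr' hpq
  have h1 : 0 ≤ 1 - p - q := by linarith
  have h2 : 0 ≤ 1 - r := by linarith
  have h3 : 0 ≤ 1 - r ^ 2 := by nlinarith
  have h4 : 0 ≤ 1 - p := by linarith
  cases a₀ <;> cases a₁ <;> cases b <;> simp only [gMatrix] <;> positivity

theorem gMatrix_sum (p q r : ℝ) (a₀ a₁ : EnvLetter) : ∑ b, gMatrix p q r a₀ a₁ b = 1 := by
  rw [EnvLetter.sum_eq]
  cases a₀ <;> cases a₁ <;> simp only [gMatrix] <;> ring

theorem eMatrix_nonneg {r s : ℝ} (h : (r, s) ∈ Theta') (a₀ a₁ b : EnvLetter) :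
    0 ≤ eMatrix r s a₀ a₁ b := by
  obtain ⟨⟨hr, hr'⟩, ⟨hs, hs'⟩, -, hrs⟩ := h
  simp only at hr hr' hs hs' hrs
  have h1 : 0 ≤ 1 - r - s := by linarith
  have h2 : 0 ≤ 1 - s := by linarith
  have h3 : 0 ≤ 1 - r ^ 2 := by nlinarith
  have h4 : 0 ≤ 2 * s - s ^ 2 := by nlinarith
  have h5 : 0 ≤ 1 - r + r * s := by nlinarith
  have h6 : 0 ≤ r - r * s := by nlinarith
  have h7 : 0 ≤ 1 + r - s := by linarith
  cases a₀ <;> cases a₁ <;> cases b <;> simp only [eMatrix] <;> positivity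

theorem eMatrix_sum (r s : ℝ) (a₀ a₁ : EnvLetter) : ∑ b, eMatrix r s a₀ a₁ b = 1 := by
  rw [EnvLetter.sum_eq]
  cases a₀ <;> cases a₁ <;> simp only [eMatrix] <;> ring

/-- The envelope PCA of `G p q r`. -/
def GHat (p q r : ℝ) (h : (p, q, r) ∈ Theta) : PCA EnvLetter where
  φ := gMatrix p q r
  nonneg := gMatrix_nonneg h
  sum_eq_one := gMatrix_sum p q r

/-- The elementary PCA `G p q r`: the restriction of its envelope to the alphabet `{W, L}`. -/
def G (p q r : ℝ) (h : (p, q, r) ∈ Theta) : PCA Letter where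
  φ a₀ a₁ b := gMatrix p q r a₀.toEnv a₁.toEnv b.toEnv
  nonneg _ _ _ := gMatrix_nonneg h _ _ _
  sum_eq_one a₀ a₁ := by
    rw [Letter.sum_eq]
    cases a₀ <;> cases a₁ <;> simp only [Letter.toEnv, gMatrix] <;> ring

/-- The envelope PCA of `E r s`. -/
def EHat (r s : ℝ) (h : (r, s) ∈ Theta') : PCA EnvLetter where
  φ := eMatrix r s
  nonneg := eMatrix_nonneg h
  sum_eq_one := eMatrix_sum r s

/-- The elementary PCA `E r s`: the restriction of its envelope to the alphabet `{W, L}`. -/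
def E (r s : ℝ) (h : (r, s) ∈ Theta') : PCA Letter where
  φ a₀ a₁ b := eMatrix r s a₀.toEnv a₁.toEnv b.toEnv
  nonneg _ _ _ := eMatrix_nonneg h _ _ _
  sum_eq_one a₀ a₁ := by
    rw [Letter.sum_eq]
    cases a₀ <;> cases a₁ <;> simp only [Letter.toEnv, eMatrix] <;> ring

/-- The inequality common to all the regimes of the generalized game. -/
def CondUniversal (p q r : ℝ) : Prop :=
  2 * (p + q) + 6 * r ^ 2 + 3 * r * (p + 2 * q) ≥ 4 * r + (p + q) ^ 2

def CondOne (p q r : ℝ) : Prop :=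
  p * (1 - p) ≤ q * (1 - q - r * (1 - p - q))

def CondTwo (p q r : ℝ) : Prop :=
  q * (1 - q - r * (1 - p - q)) < p * (1 - p) ∧
  p * (1 - p) ≤ (q + r * (1 - p - q)) * (1 - q - r * (1 - p - q)) ∧
  p - 2 * q + p * q + q * r - 3 * p * r - 2 * p ^ 2 + 3 * q ^ 2 ≤ 0

def CondThree (p q r : ℝ) : Prop :=
  q * (1 - q - r * (1 - p - q)) < p * (1 - p) ∧
  p * (1 - p) ≤ (q + r * (1 - p - q)) * (1 - q - r * (1 - p - q)) ∧
  p - 2 * q + p * q + q * r - 3 * p * r - 2 * p ^ 2 + 3 * q ^ 2 > 0 ∧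
  p + 4 * q + 9 * p * r + 5 * q * r + 6 * r ^ 2 ≥ 4 * r + p ^ 2 + 4 * q ^ 2 + 5 * p * q

def CondFour (p q r : ℝ) : Prop :=
  q + r * (1 - p - q) < p ∧
  6 * q + 10 * p * r + 4 * q * r + p ^ 2 + 6 * r ^ 2 ≥ 4 * r + 6 * p * q + 7 * q ^ 2

/-- The inequality of the small-parameter regime of the bond game. -/
def CondBond (r s : ℝ) : Prop :=
  3 * (2 * s - s ^ 2) ^ 2 / 2 + 8 * (2 * s - s ^ 2) * r / (1 - s)
      + 11 * r ^ 2 / (2 * (1 - s) ^ 2) ≥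
    2 * r / (1 - s) + 9 * (2 * s - s ^ 2) ^ 3 / 2 + 16 * (2 * s - s ^ 2) ^ 2 * r / (1 - s)
      + 43 * (2 * s - s ^ 2) * r ^ 2 / (2 * (1 - s) ^ 2) + 5 * r ^ 3 / (1 - s) ^ 3

end PercPCA

namespace PercPCA

open MeasureTheory ProbabilityTheory Filter Topology

set_option linter.unusedSectionVars false

/-! The letter `D` means "not yet known". A cell of the envelope is a function of local noise: its
vertex is a trap (`W`), a target (`L`) or open, and each of its two edges is blocked or not. An open
cell wins if it sees an `L` through an unblocked edge, is undecided if it sees a `D` but no `L`, and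
otherwise loses. Replacing `D` by another letter in the inputs never changes an output other than
`D`. Run with the same noise from the all-`D` configuration and from an arbitrary law: the two
copies agree wherever the first is decided. Hence the initial law influences a cylinder at time `t`
by at most the number of its cells times the density of `D` in the all-`D` evolution
(`abs_real_cyl_sub_le`). If this density tends to zero, compactness yields ergodicity of the
envelope, and of its restriction, whose configurations are special configurations of the envelope
(`isErgodic_of_undecided_tendsto_zero`).

The density of `D` is controlled by a potential: a combination of the probabilities of `D`, `WD`,
`LWD`, `DWD` and `DD`. One update changes the potential by a quantity that the word probabilities
bound linearly. If the coefficients satisfy finitely many inequalities (`IsAdmissible`), each update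
lowers the potential by at least `κ` times the density of `D` (`Evolves.potential_le`). The
potential is bounded below, so the densities are summable and tend to zero.

It remains to exhibit coefficients. Near the origin all the conditions of the theorem are used only
through `r ≤ 17/10 q + 4/5 p²` (`le_of_conditions`, `le_of_condBond`), under which second-order
expansions in `p` suffice (`isAdmissible_small`). The bond game is the generalized game with `p =
2s' - s'²`, `q = 0` and blocking probability `r'/(1 - s')`; its regimes away from the origin have
explicit coefficients. -/

namespace PCA

/-! ### Cylinders, one-step laws and maps that intertwine PCAs. -/

section General

variable {A : Type} [Fintype A] [MeasurableSpace A] [DiscreteMeasurableSpace A]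

theorem cellLaw_singleton (F : PCA A) (a₀ a₁ b : A) :
    F.cellLaw a₀ a₁ {b} = ENNReal.ofReal (F.φ a₀ a₁ b) := by
  classical
  simp only [cellLaw, Measure.coe_finsetSum, Finset.sum_apply, Measure.smul_apply, smul_eq_mul]
  rw [Finset.sum_eq_single b]
  · simp
  · intro c _ hc
    simp [hc]
  · simp

/-- The configurations that agree with `u` on the finite window `S`. -/
def cyl (S : Finset ℤ) (u : ℤ → A) : Set (ℤ → A) := Set.pi S fun x => {u x}

theorem measurableSet_cyl (S : Finset ℤ) (u : ℤ → A) : MeasurableSet (cyl S u) :=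
  .pi S.countable_toSet fun _ _ => .of_discrete

theorem configLaw_cyl (F : PCA A) (η : ℤ → A) (S : Finset ℤ) (u : ℤ → A) :
    F.configLaw η (cyl S u) = ENNReal.ofReal (∏ x ∈ S, F.φ (η x) (η (x + 1)) (u x)) := by
  rw [configLaw, cyl, Measure.infinitePi_pi _ fun _ _ => .of_discrete,
    ENNReal.ofReal_prod_of_nonneg fun x _ => F.nonneg _ _ _]
  simp only [cellLaw_singleton]

theorem integral_comp_eq_sum {μ : Measure (ℤ → A)} [IsFiniteMeasure μ] {ι : Type*}
    [Fintype ι] [MeasurableSpace ι] [DiscreteMeasurableSpace ι] {g : (ℤ → A) → ι}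
    (hg : Measurable g) (f : ι → ℝ) :
    ∫ η, f (g η) ∂μ = ∑ i, f i * μ.real (g ⁻¹' {i}) := by
  have hf : AEStronglyMeasurable f (μ.map g) := Measurable.of_discrete.aestronglyMeasurable
  rw [← integral_map hg.aemeasurable hf, integral_fintype]
  · refine Finset.sum_congr rfl fun i _ => ?_
    rw [map_measureReal_apply hg .of_discrete, smul_eq_mul, mul_comm]
  · exact .of_finite

theorem step_apply (F : PCA A) (μ : ProbabilityMeasure (ℤ → A)) {s : Set (ℤ → A)}
    (hs : MeasurableSet s) : (F.step μ : Measure (ℤ → A)) s = ∫⁻ η, F.configLaw η s ∂μ :=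
  Measure.bind_apply hs F.kernel.aemeasurable

theorem step_cyl (F : PCA A) (μ : ProbabilityMeasure (ℤ → A)) (S : Finset ℤ) (u : ℤ → A) :
    (F.step μ : Measure (ℤ → A)).real (cyl S u) =
      ∫ η, ∏ x ∈ S, F.φ (η x) (η (x + 1)) (u x) ∂(μ : Measure (ℤ → A)) := by
  rw [integral_eq_lintegral_of_nonneg_ae]
  · rw [measureReal_def, F.step_apply μ (measurableSet_cyl S u)]
    simp only [configLaw_cyl]
  · exact .of_forall fun η => Finset.prod_nonneg fun x _ => F.nonneg _ _ _
  · refine (Finset.measurable_fun_prod S fun x _ => ?_).aestronglyMeasurable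
    have hpair : Measurable fun η : ℤ → A => (η x, η (x + 1)) := by fun_prop
    exact (Measurable.of_discrete (f := fun z : A × A => F.φ z.1 z.2 (u x))).comp hpair

theorem ext_cyl {μ ν : ProbabilityMeasure (ℤ → A)}
    (h : ∀ S u, (μ : Measure (ℤ → A)).real (cyl S u) = (ν : Measure (ℤ → A)).real (cyl S u)) :
    μ = ν := by
  apply Subtype.ext
  have : IsProbabilityMeasure (μ : Measure (ℤ → A)) := inferInstance
  change (μ : Measure (ℤ → A)) = (ν : Measure (ℤ → A))
  refine ext_of_generate_finite {s | ∃ S u, s = cyl S u} (le_antisymm ?_ ?_) ?_ ?_ (by simp)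
  · refine iSup_le fun x => ?_
    rintro _ ⟨s, -, rfl⟩
    have : (fun η : ℤ → A => η x) ⁻¹' s = ⋃ a ∈ s, cyl {x} fun _ => a := by
      ext η
      simp [cyl]
    rw [this]
    refine MeasurableSet.biUnion s.to_countable fun a _ => ?_
    exact MeasurableSpace.measurableSet_generateFrom ⟨_, _, rfl⟩
  · refine MeasurableSpace.generateFrom_le ?_
    rintro _ ⟨S, u, rfl⟩
    exact measurableSet_cyl S u
  · classical
    rintro _ ⟨S, u, rfl⟩ _ ⟨S', u', rfl⟩ ⟨η, h₁, h₂⟩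
    -- Two cylinders that meet at `η` intersect in the cylinder of `η` on the union of their
    -- windows.
    refine ⟨S ∪ S', η, ?_⟩
    simp only [cyl, Set.mem_pi, Set.mem_singleton_iff, Finset.mem_coe] at h₁ h₂
    ext ζ
    simp only [cyl, Set.mem_inter_iff, Set.mem_pi, Set.mem_singleton_iff, Finset.mem_coe,
      Finset.mem_union]
    constructor
    · rintro ⟨k₁, k₂⟩ x (hx | hx)
      · rw [k₁ x hx, h₁ x hx]
      · rw [k₂ x hx, h₂ x hx]
    · exact fun k => ⟨fun x hx => by rw [k x (.inl hx), h₁ x hx],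
        fun x hx => by rw [k x (.inr hx), h₂ x hx]⟩
  · rintro _ ⟨S, u, rfl⟩
    exact (measureReal_eq_measureReal_iff).1 (h S u)

/-- A map of configurations that intertwines the one-step laws intertwines the evolutions. -/
theorem map_iterate_step {B : Type} [Fintype B] [MeasurableSpace B] [DiscreteMeasurableSpace B]
    (F : PCA A) (F' : PCA B) {Θ : (ℤ → A) → (ℤ → B)} (hΘ : Measurable Θ)
    (h : ∀ η, (F.configLaw η).map Θ = F'.configLaw (Θ η)) {μ : ProbabilityMeasure (ℤ → A)}
    {ν : ProbabilityMeasure (ℤ → B)} (hμ : (μ : Measure (ℤ → A)).map Θ = ν) (t : ℕ) :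
    (F.step^[t] μ : Measure (ℤ → A)).map Θ = (F'.step^[t] ν : Measure (ℤ → B)) := by
  induction t with
  | zero => exact hμ
  | succ t ih =>
    rw [Function.iterate_succ_apply', Function.iterate_succ_apply']
    ext s hs
    rw [Measure.map_apply hΘ hs, F.step_apply _ (hΘ hs), F'.step_apply _ hs, ← ih,
      lintegral_map (show Measurable fun η => F'.configLaw η s from F'.kernel.measurable_coe hs) hΘ]
    refine lintegral_congr fun η => ?_
    rw [← h, Measure.map_apply hΘ hs]

/-- A letter-to-letter map that lumps one stochastic matrix into another intertwines the one-step
laws. -/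
theorem map_configLaw_of_lump {B : Type} [Fintype B] [MeasurableSpace B]
    [DiscreteMeasurableSpace B] [DecidableEq B] (F : PCA A) (F' : PCA B) (θ : A → B)
    (h : ∀ a₀ a₁ b', ∑ b, (if θ b = b' then F.φ a₀ a₁ b else 0) = F'.φ (θ a₀) (θ a₁) b')
    (η : ℤ → A) :
    (F.configLaw η).map (fun ζ x => θ (ζ x)) = F'.configLaw fun x => θ (η x) := by
  have hcell : ∀ a₀ a₁, (F.cellLaw a₀ a₁).map θ = F'.cellLaw (θ a₀) (θ a₁) := by
    intro a₀ a₁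
    refine Measure.ext_of_singleton fun b' => ?_
    rw [Measure.map_apply .of_discrete .of_discrete, cellLaw_singleton, ← h,
      ENNReal.ofReal_sum_of_nonneg]
    · simp only [cellLaw, Measure.coe_finsetSum, Finset.sum_apply, Measure.smul_apply,
        smul_eq_mul]
      refine Finset.sum_congr rfl fun b _ => ?_
      by_cases hb : θ b = b' <;> simp [hb]
    · intro b _
      split_ifs
      exacts [F.nonneg _ _ _, le_rfl]
  simp only [configLaw, ← hcell]
  exact Measure.infinitePi_map_pi _ fun _ => .of_discrete

/-- The shift of configurations. -/
def shift (η : ℤ → A) : ℤ → A := fun x => η (x + 1)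

theorem measurable_shift : Measurable (shift : (ℤ → A) → ℤ → A) :=
  measurable_pi_lambda _ fun x => measurable_pi_apply (x + 1)

theorem map_configLaw_shift (F : PCA A) (η : ℤ → A) :
    (F.configLaw η).map shift = F.configLaw (shift η) := by
  refine Measure.eq_infinitePi _ fun s t ht => ?_
  rw [Measure.map_apply measurable_shift (.pi s.countable_toSet fun _ _ => ht _)]
  have : shift ⁻¹' (Set.pi s t : Set (ℤ → A)) =
      Set.pi (s.map (addRightEmbedding 1)) fun x => t (x - 1) := by
    ext ζ
    simp only [Set.mem_preimage, Set.mem_pi, Finset.mem_coe, Finset.mem_map, shift]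
    constructor
    · rintro h _ ⟨x, hx, rfl⟩
      simpa using h x hx
    · intro h x hx
      simpa using h (x + 1) ⟨x, hx, rfl⟩
  rw [this, configLaw, Measure.infinitePi_pi _ fun _ _ => ht _, Finset.prod_map]
  simp [shift]

end General

/-! ### Compactness and a criterion for ergodicity. -/

section Ergodic

variable {A : Type} [Fintype A] [MeasurableSpace A] [DiscreteMeasurableSpace A]
  [TopologicalSpace A] [DiscreteTopology A]

theorem continuous_integral {f : (ℤ → A) → ℝ} (hf : Continuous f) :
    Continuous fun μ : ProbabilityMeasure (ℤ → A) => ∫ η, f η ∂(μ : Measure (ℤ → A)) := by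
  rw [continuous_iff_continuousAt]
  intro μ
  exact (ProbabilityMeasure.tendsto_iff_forall_integral_tendsto.1 tendsto_id)
    (BoundedContinuousFunction.mkOfCompact ⟨f, hf⟩)

theorem isClopen_cyl (S : Finset ℤ) (u : ℤ → A) : IsClopen (cyl S u) :=
  ⟨isClosed_set_pi fun _ _ => isClosed_discrete _,
    isOpen_set_pi S.finite_toSet fun _ _ => isOpen_discrete _⟩

theorem continuous_real_cyl (S : Finset ℤ) (u : ℤ → A) :
    Continuous fun μ : ProbabilityMeasure (ℤ → A) => (μ : Measure (ℤ → A)).real (cyl S u) := by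
  have := continuous_integral (A := A) (f := (cyl S u).indicator fun _ => 1)
    ((isClopen_cyl S u).continuous_indicator continuous_const)
  simpa [integral_indicator (measurableSet_cyl S u)] using this

theorem continuous_step_real_cyl (F : PCA A) (S : Finset ℤ) (u : ℤ → A) :
    Continuous fun μ : ProbabilityMeasure (ℤ → A) =>
      (F.step μ : Measure (ℤ → A)).real (cyl S u) := by
  simp only [step_cyl]
  refine continuous_integral (continuous_finsetProd _ fun x _ => ?_)
  have hpair : Continuous fun η : ℤ → A => (η x, η (x + 1)) := by fun_prop
  exact (continuous_of_discreteTopology (f := fun z : A × A => F.φ z.1 z.2 (u x))).comp hpair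

/-- Convergence of the probabilities of all cylinders implies weak convergence. -/
theorem tendsto_of_tendsto_cyl {μs : ℕ → ProbabilityMeasure (ℤ → A)}
    {μ : ProbabilityMeasure (ℤ → A)}
    (h : ∀ S u, Tendsto (fun t => (μs t : Measure (ℤ → A)).real (cyl S u)) atTop
      (𝓝 ((μ : Measure (ℤ → A)).real (cyl S u)))) :
    Tendsto μs atTop (𝓝 μ) := by
  rw [tendsto_iff_ultrafilter]
  intro g hg
  obtain ⟨ν, -, hν⟩ := (isCompact_univ (X := ProbabilityMeasure (ℤ → A))).ultrafilter_le_nhds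
    (g.map μs) (by simp)
  have : ν = μ := ext_cyl fun S u =>
    tendsto_nhds_unique (((continuous_real_cyl S u).tendsto ν).comp hν) ((h S u).mono_left hg)
  exact this ▸ hν

/-- A PCA is ergodic as soon as the influence of the initial law on every cylinder vanishes. -/
theorem isErgodic_of_forget (F : PCA A) (μ₀ : ProbabilityMeasure (ℤ → A))
    (d : Finset ℤ → ℕ → ℝ) (hd : ∀ S, Tendsto (d S) atTop (𝓝 0))
    (h : ∀ ν S u t, |(F.step^[t] ν : Measure (ℤ → A)).real (cyl S u) -
      (F.step^[t] μ₀ : Measure (ℤ → A)).real (cyl S u)| ≤ d S t) : F.IsErgodic := by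
  have hdiff : ∀ ν S u, Tendsto (fun t => (F.step^[t] ν : Measure (ℤ → A)).real (cyl S u) -
      (F.step^[t] μ₀ : Measure (ℤ → A)).real (cyl S u)) atTop (𝓝 0) := fun ν S u =>
    squeeze_zero_norm (fun t => h ν S u t) (hd S)
  -- The stationary law is a limit of the orbit of `μ₀` along a nonprincipal ultrafilter.
  obtain ⟨μ, -, hμ⟩ := (isCompact_univ (X := ProbabilityMeasure (ℤ → A))).ultrafilter_le_nhds
    ((hyperfilter ℕ : Ultrafilter ℕ).map fun t => F.step^[t] μ₀) (by simp)
  have hμ' : Tendsto (fun t => F.step^[t] μ₀) (hyperfilter ℕ : Filter ℕ) (𝓝 μ) := hμ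
  have hle : (hyperfilter ℕ : Filter ℕ) ≤ atTop := Nat.hyperfilter_le_atTop
  -- Updating the orbit of `μ₀` amounts to starting it from `F.step μ₀`. By hypothesis this changes
  -- no cylinder probability in the limit, so the limit point is fixed without time averaging.
  have hstat : F.step μ = μ := ext_cyl fun S u => by
    have h₁ := ((F.continuous_step_real_cyl S u).tendsto μ).comp hμ'
    have h₂ := ((continuous_real_cyl S u).tendsto μ).comp hμ'
    have h₃ := (hdiff (F.step μ₀) S u).mono_left hle
    have h₄ := h₂.add h₃
    rw [add_zero] at h₄
    refine tendsto_nhds_unique h₁ (h₄.congr fun t => ?_)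
    simp [← Function.iterate_succ_apply, Function.iterate_succ_apply']
  have hfix : ∀ ν, F.step ν = ν → ∀ t, F.step^[t] ν = ν := fun ν hν t =>
    Function.iterate_fixed hν t
  have hlim : ∀ ν, Tendsto (fun t => F.step^[t] ν) atTop (𝓝 μ) := fun ν =>
    tendsto_of_tendsto_cyl fun S u => by
      have := ((hdiff ν S u).sub (hdiff μ S u)).add_const ((μ : Measure (ℤ → A)).real (cyl S u))
      simp only [sub_zero, zero_add, hfix μ hstat] at this
      exact this.congr fun t => by ring
  refine ⟨μ, hstat, fun ν hν => ?_, hlim⟩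
  have := hlim ν
  simp only [hfix ν hν] at this
  exact tendsto_nhds_unique tendsto_const_nhds this

end Ergodic

end PCA

/-! ### Noise representation and coupling with the undecided evolution. -/

/-- The randomness used by a cell: the type of its vertex (trap, target or open) and whether each
of its two outgoing edges is blocked. -/
abbrev Noise : Type := Fin 3 × Bool × Bool

def noiseWeight (p q r : ℝ) (ω : Noise) : ℝ :=
  ![p, q, 1 - p - q] ω.1 * (if ω.2.1 then r else 1 - r) * (if ω.2.2 then r else 1 - r)

/-- The outcome of a cell as a function of its randomness and of the states of its neighbours. -/
def noiseUpdate (ω : Noise) (a₀ a₁ : EnvLetter) : EnvLetter :=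
  if ω.1 = 0 then .W else if ω.1 = 1 then .L
  else if (ω.2.1 = false ∧ a₀ = .L) ∨ (ω.2.2 = false ∧ a₁ = .L) then .W
  else if (ω.2.1 = false ∧ a₀ = .D) ∨ (ω.2.2 = false ∧ a₁ = .D) then .D
  else .L

theorem noiseWeight_nonneg {p q r : ℝ} (h : (p, q, r) ∈ Theta) (ω : Noise) :
    0 ≤ noiseWeight p q r ω := by
  obtain ⟨⟨hp, hp'⟩, ⟨hq, hq'⟩, ⟨hr, hr'⟩, -, hpq⟩ := h
  simp only at hp hp' hq hq' hr hr' hpq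
  have hr'' : 0 ≤ 1 - r := by linarith
  have h1 : 0 ≤ 1 - p - q := by linarith
  obtain ⟨i, e₀, e₁⟩ := ω
  fin_cases i <;> cases e₀ <;> cases e₁ <;> simp [noiseWeight] <;> positivity

theorem sum_noiseWeight_noiseUpdate (p q r : ℝ) (a₀ a₁ b : EnvLetter) :
    ∑ ω, (if noiseUpdate ω a₀ a₁ = b then noiseWeight p q r ω else 0) = gMatrix p q r a₀ a₁ b := by
  simp only [Fintype.sum_prod_type, Fin.sum_univ_three, Fintype.sum_bool]
  cases a₀ <;> cases a₁ <;> cases b <;> simp [noiseUpdate, noiseWeight, gMatrix] <;> ring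

theorem sum_noiseWeight (p q r : ℝ) : ∑ ω, noiseWeight p q r ω = 1 := by
  simp only [Fintype.sum_prod_type, Fin.sum_univ_three, Fintype.sum_bool, noiseWeight]
  simp
  ring

/-- Pairs of states of which the first is undecided or agrees with the second. -/
abbrev Refinement : Type := {z : EnvLetter × EnvLetter // z.1 = .D ∨ z.1 = z.2}

/-- `D` stands for missing information: the update returns `W` or `L` only when the noise and the
decided neighbours already force that outcome. This monotonicity is what keeps the coupling inside
`Refinement`. -/
theorem noiseUpdate_refines (ω : Noise) (z₀ z₁ : Refinement) :
    noiseUpdate ω z₀.1.1 z₁.1.1 = .D ∨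
      noiseUpdate ω z₀.1.1 z₁.1.1 = noiseUpdate ω z₀.1.2 z₁.1.2 := by
  revert ω z₀ z₁
  decide

def refinementUpdate (ω : Noise) (z₀ z₁ : Refinement) : Refinement :=
  ⟨(noiseUpdate ω z₀.1.1 z₁.1.1, noiseUpdate ω z₀.1.2 z₁.1.2), noiseUpdate_refines ω z₀ z₁⟩

/-- The coupling of two copies of `GHat p q r` that use the same randomness, where the first copy
has less information than the second. -/
def coupling (p q r : ℝ) (h : (p, q, r) ∈ Theta) : PCA Refinement where
  φ z₀ z₁ z := ∑ ω, if refinementUpdate ω z₀ z₁ = z then noiseWeight p q r ω else 0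
  nonneg z₀ z₁ z := Finset.sum_nonneg fun ω _ => by
    split_ifs
    exacts [noiseWeight_nonneg h ω, le_rfl]
  sum_eq_one z₀ z₁ := by
    rw [Finset.sum_comm]
    simp [sum_noiseWeight]

/-- With a coordinate projection as `θ`, this shows that each coordinate of the coupling evolves as
the envelope. -/
theorem coupling_lump {p q r : ℝ} (h : (p, q, r) ∈ Theta) (θ : Refinement → EnvLetter)
    (hθ : ∀ ω z₀ z₁, θ (refinementUpdate ω z₀ z₁) = noiseUpdate ω (θ z₀) (θ z₁))
    (z₀ z₁ : Refinement) (b : EnvLetter) :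
    ∑ z, (if θ z = b then (coupling p q r h).φ z₀ z₁ z else 0) =
      (GHat p q r h).φ (θ z₀) (θ z₁) b := by
  simp only [coupling, GHat, ← sum_noiseWeight_noiseUpdate, ← hθ]
  have : ∀ z, (if θ z = b then ∑ ω, (if refinementUpdate ω z₀ z₁ = z then noiseWeight p q r ω
      else 0) else 0) = ∑ ω, if refinementUpdate ω z₀ z₁ = z then
        (if θ z = b then noiseWeight p q r ω else 0) else 0 := by
    intro z
    split_ifs <;> simp
  simp only [this]
  rw [Finset.sum_comm]
  simp

theorem measurableSet_eval_eq (x : ℤ) (a : EnvLetter) :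
    MeasurableSet {η : ℤ → EnvLetter | η x = a} :=
  measurable_pi_apply (X := fun _ : ℤ => EnvLetter) x (MeasurableSet.of_discrete (s := {a}))

/-- The law of the totally undecided configuration. -/
noncomputable def undecided : ProbabilityMeasure (ℤ → EnvLetter) :=
  ⟨Measure.dirac fun _ => .D, inferInstance⟩

open PCA

/-- Under the coupling started from (`D`, `ν`), the two copies can disagree on the window only if
the first has a `D` there; a union bound over the window concludes. -/
theorem abs_real_cyl_sub_le {p q r : ℝ} (h : (p, q, r) ∈ Theta)
    (ν : ProbabilityMeasure (ℤ → EnvLetter)) (S : Finset ℤ) (u : ℤ → EnvLetter) (t : ℕ) :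
    |((GHat p q r h).step^[t] ν : Measure (ℤ → EnvLetter)).real (cyl S u) -
      ((GHat p q r h).step^[t] undecided : Measure (ℤ → EnvLetter)).real (cyl S u)| ≤
    ∑ x ∈ S, ((GHat p q r h).step^[t] undecided : Measure (ℤ → EnvLetter)).real
      {η | η x = .D} := by
  let ι : EnvLetter → Refinement := fun a => ⟨(.D, a), .inl rfl⟩
  have hι : Measurable fun (η : ℤ → EnvLetter) x => ι (η x) :=
    measurable_pi_lambda _ fun x =>
      (Measurable.of_discrete (f := ι)).comp (measurable_pi_apply x)
  let ρ₀ : ProbabilityMeasure (ℤ → Refinement) := ν.map hι.aemeasurable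
  let ρ := (coupling p q r h).step^[t] ρ₀
  have hπ : ∀ θ : Refinement → EnvLetter, Measurable fun (z : ℤ → Refinement) x => θ (z x) :=
    fun θ => measurable_pi_lambda _ fun x =>
      (Measurable.of_discrete (f := θ)).comp (measurable_pi_apply x)
  have h₁ : (ρ : Measure (ℤ → Refinement)).map (fun z x => (z x).1.1) =
      ((GHat p q r h).step^[t] undecided : Measure (ℤ → EnvLetter)) := by
    refine map_iterate_step _ _ (hπ fun z => z.1.1)
      (map_configLaw_of_lump _ _ (fun z : Refinement => z.1.1)
      (coupling_lump h (fun z => z.1.1) fun _ _ _ => rfl)) ?_ t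
    change ((ν : Measure (ℤ → EnvLetter)).map _).map _ = _
    rw [Measure.map_map (hπ fun z => z.1.1) hι]
    change Measure.map (fun _ _ => EnvLetter.D) _ = _
    rw [Measure.map_const]
    simp [undecided]
  have h₂ : (ρ : Measure (ℤ → Refinement)).map (fun z x => (z x).1.2) =
      ((GHat p q r h).step^[t] ν : Measure (ℤ → EnvLetter)) := by
    refine map_iterate_step _ _ (hπ fun z => z.1.2)
      (map_configLaw_of_lump _ _ (fun z : Refinement => z.1.2)
      (coupling_lump h (fun z => z.1.2) fun _ _ _ => rfl)) ?_ t
    change ((ν : Measure (ℤ → EnvLetter)).map _).map _ = _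
    rw [Measure.map_map (hπ fun z => z.1.2) hι]
    exact Measure.map_id
  rw [← h₁, ← h₂]
  simp only [map_measureReal_apply (hπ fun z => z.1.1) (measurableSet_cyl S u),
    map_measureReal_apply (hπ fun z => z.1.2) (measurableSet_cyl S u),
    map_measureReal_apply (hπ fun z => z.1.1) (measurableSet_eval_eq _ _)]
  set X : Set (ℤ → Refinement) := (fun z x => (z x).1.2) ⁻¹' cyl S u
  set Y : Set (ℤ → Refinement) := (fun z x => (z x).1.1) ⁻¹' cyl S u
  have key : ∀ z : ℤ → Refinement, (∀ x ∈ S, (z x).1.1 ≠ .D) → (z ∈ X ↔ z ∈ Y) := by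
    intro z hz
    simp only [X, Y, cyl, Set.mem_preimage, Set.mem_pi, Finset.mem_coe, Set.mem_singleton_iff]
    refine forall₂_congr fun x hxS => ?_
    rw [(z x).2.resolve_left (hz x hxS)]
  have hU : ∀ z : ℤ → Refinement, z ∉ (⋃ x ∈ S, {z : ℤ → Refinement | (z x).1.1 = .D}) →
      (z ∈ X ↔ z ∈ Y) := fun z hz => key z fun x hxS hD =>
    hz (Set.mem_biUnion (Finset.mem_coe.2 hxS) hD)
  have hsum := measureReal_biUnion_finset_le (μ := (ρ : Measure (ℤ → Refinement))) S
    fun x => {z : ℤ → Refinement | (z x).1.1 = .D}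
  have hXY : (ρ : Measure (ℤ → Refinement)).real X ≤ (ρ : Measure (ℤ → Refinement)).real Y +
      (ρ : Measure (ℤ → Refinement)).real (⋃ x ∈ S, {z : ℤ → Refinement | (z x).1.1 = .D}) :=
    (measureReal_mono fun z hz => by
      by_cases hzU : z ∈ (⋃ x ∈ S, {z : ℤ → Refinement | (z x).1.1 = .D})
      exacts [.inr hzU, .inl ((hU z hzU).1 hz)]).trans (measureReal_union_le _ _)
  have hYX : (ρ : Measure (ℤ → Refinement)).real Y ≤ (ρ : Measure (ℤ → Refinement)).real X +
      (ρ : Measure (ℤ → Refinement)).real (⋃ x ∈ S, {z : ℤ → Refinement | (z x).1.1 = .D}) :=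
    (measureReal_mono fun z hz => by
      by_cases hzU : z ∈ (⋃ x ∈ S, {z : ℤ → Refinement | (z x).1.1 = .D})
      exacts [.inr hzU, .inl ((hU z hzU).2 hz)]).trans (measureReal_union_le _ _)
  exact (abs_sub_le_iff.2 ⟨sub_le_iff_le_add'.2 hXY, sub_le_iff_le_add'.2 hYX⟩).trans hsum

/-- The law of the undecided configuration stays shift invariant. -/
theorem map_shift_iterate_undecided {p q r : ℝ} (h : (p, q, r) ∈ Theta) (t : ℕ) :
    ((GHat p q r h).step^[t] undecided : Measure (ℤ → EnvLetter)).map shift =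
      ((GHat p q r h).step^[t] undecided : Measure (ℤ → EnvLetter)) := by
  refine map_iterate_step _ _ measurable_shift (map_configLaw_shift _) ?_ t
  simp only [undecided, ProbabilityMeasure.coe_mk]
  exact Measure.map_dirac' measurable_shift _

theorem real_eq_D_eq {p q r : ℝ} (h : (p, q, r) ∈ Theta) (t : ℕ) (x : ℤ) :
    ((GHat p q r h).step^[t] undecided : Measure (ℤ → EnvLetter)).real {η | η x = .D} =
      ((GHat p q r h).step^[t] undecided : Measure (ℤ → EnvLetter)).real {η | η 0 = .D} := by
  have hsucc : ∀ x, ((GHat p q r h).step^[t] undecided : Measure (ℤ → EnvLetter)).real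
      {η | η (x + 1) = .D} =
      ((GHat p q r h).step^[t] undecided : Measure (ℤ → EnvLetter)).real {η | η x = .D} := by
    intro x
    conv_rhs => rw [← map_shift_iterate_undecided,
      map_measureReal_apply measurable_shift (measurableSet_eval_eq x _)]
    rfl
  induction x using Int.induction_on with
  | zero => rfl
  | succ i ih => rw [hsucc, ih]
  | pred i ih => rw [← ih, ← hsucc, sub_add_cancel]

theorem G_lump {p q r : ℝ} (h : (p, q, r) ∈ Theta) (a₀ a₁ : Letter) (b : EnvLetter) :
    ∑ c : Letter, (if c.toEnv = b then (G p q r h).φ a₀ a₁ c else 0) =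
      (GHat p q r h).φ a₀.toEnv a₁.toEnv b := by
  rw [Letter.sum_eq]
  cases a₀ <;> cases a₁ <;> cases b <;> simp [G, GHat, Letter.toEnv, gMatrix]

theorem Letter.toEnv_injective : Function.Injective Letter.toEnv := by
  rintro (_ | _) (_ | _) <;> simp [Letter.toEnv]

/-- Both PCAs are ergodic if undecided cells die out under the envelope. -/
theorem isErgodic_of_undecided_tendsto_zero {p q r : ℝ} (h : (p, q, r) ∈ Theta)
    (hD : Tendsto (fun t => ((GHat p q r h).step^[t] undecided : Measure (ℤ → EnvLetter)).real
      {η | η 0 = .D}) atTop (𝓝 0)) :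
    (G p q r h).IsErgodic ∧ (GHat p q r h).IsErgodic := by
  set d : ℕ → ℝ := fun t => ((GHat p q r h).step^[t] undecided : Measure (ℤ → EnvLetter)).real
      {η | η 0 = .D} with hd_def
  have bound : ∀ ν S u t, |((GHat p q r h).step^[t] ν : Measure (ℤ → EnvLetter)).real (cyl S u) -
      ((GHat p q r h).step^[t] undecided : Measure (ℤ → EnvLetter)).real (cyl S u)| ≤
      S.card * d t := by
    intro ν S u t
    refine (abs_real_cyl_sub_le h ν S u t).trans_eq ?_
    rw [Finset.sum_congr rfl fun x _ => real_eq_D_eq h t x, Finset.sum_const, nsmul_eq_mul]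
  constructor
  · let ν₀ : ProbabilityMeasure (ℤ → Letter) := ⟨Measure.dirac fun _ => .W, inferInstance⟩
    -- The factor 2 is the triangle inequality: the undecided law does not live on `{W, L}`, so two
    -- embedded laws are compared through it.
    refine isErgodic_of_forget _ ν₀ (fun S t => 2 * (S.card * d t)) (fun S => ?_) ?_
    · simpa using (hD.const_mul (S.card : ℝ)).const_mul 2
    · intro ν S u t
      have hθ : Measurable fun (η : ℤ → Letter) x => (η x).toEnv :=
        measurable_pi_lambda _ fun x =>
          (Measurable.of_discrete (f := Letter.toEnv)).comp (measurable_pi_apply x)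
      have emb : ∀ ν : ProbabilityMeasure (ℤ → Letter),
          ((G p q r h).step^[t] ν : Measure (ℤ → Letter)).real (cyl S u) =
          ((GHat p q r h).step^[t] (ν.map hθ.aemeasurable) : Measure (ℤ → EnvLetter)).real
            (cyl S fun x => (u x).toEnv) := by
        intro ν
        rw [← map_iterate_step (G p q r h) (GHat p q r h) hθ
          (map_configLaw_of_lump _ _ Letter.toEnv (G_lump h)) (μ := ν) rfl t,
          map_measureReal_apply hθ (measurableSet_cyl _ _)]
        congr 1
        ext η
        simp [cyl, Letter.toEnv_injective.eq_iff]
      rw [emb, emb]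
      have h₁ := bound (ν.map hθ.aemeasurable) S (fun x => (u x).toEnv) t
      have h₂ := bound (ν₀.map hθ.aemeasurable) S (fun x => (u x).toEnv) t
      rw [abs_le] at h₁ h₂ ⊢
      constructor <;> linarith [h₁.1, h₁.2, h₂.1, h₂.2]
  · exact isErgodic_of_forget _ undecided (fun S t => S.card * d t)
      (fun S => by simpa using hD.const_mul (S.card : ℝ)) bound

/-! ### How the probabilities of short words change under one update. -/

/-- The probabilities of the words of length four under a shift invariant and reflection
invariant law on configurations. -/
structure IsWordLaw (m : EnvLetter → EnvLetter → EnvLetter → EnvLetter → ℝ) : Prop where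
  nonneg : ∀ a b c d, 0 ≤ m a b c d
  rev : ∀ a b c d, m a b c d = m d c b a
  shift : ∀ a b c, ∑ x, m a b c x = ∑ x, m x a b c

section Words

variable (m m' : EnvLetter → EnvLetter → EnvLetter → EnvLetter → ℝ)

/-- The probability of a word of length three. -/
def word₃ (a b c : EnvLetter) : ℝ := ∑ x, m a b c x

/-- The probability of a word of length two. -/
def word₂ (a b : EnvLetter) : ℝ := ∑ x, word₃ m a b x

/-- The probability of a letter. -/
def word₁ (a : EnvLetter) : ℝ := ∑ x, word₂ m a x

/-- `m'` is the word law obtained from `m` by one update of the envelope of `G p q r`. -/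
def Evolves (p q r : ℝ) : Prop := ∀ x y z, word₃ m' x y z = ∑ a, ∑ b, ∑ c, ∑ d,
  gMatrix p q r a b x * gMatrix p q r b c y * gMatrix p q r c d z * m a b c d

variable {m m'} {p q r : ℝ}

theorem IsWordLaw.word₃_eq (h : IsWordLaw m) (a b c : EnvLetter) :
    word₃ m a b c = ∑ x, m x a b c := h.shift a b c

theorem IsWordLaw.word₃_nonneg (h : IsWordLaw m) (a b c : EnvLetter) : 0 ≤ word₃ m a b c :=
  Finset.sum_nonneg fun _ _ => h.nonneg _ _ _ _

theorem IsWordLaw.word₂_nonneg (h : IsWordLaw m) (a b : EnvLetter) : 0 ≤ word₂ m a b :=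
  Finset.sum_nonneg fun _ _ => h.word₃_nonneg _ _ _

theorem IsWordLaw.word₁_nonneg (h : IsWordLaw m) (a : EnvLetter) : 0 ≤ word₁ m a :=
  Finset.sum_nonneg fun _ _ => h.word₂_nonneg _ _

theorem IsWordLaw.word₃_rev (h : IsWordLaw m) (a b c : EnvLetter) :
    word₃ m a b c = word₃ m c b a := by
  rw [h.word₃_eq]
  exact Finset.sum_congr rfl fun x _ => h.rev _ _ _ _

theorem IsWordLaw.word₂_eq (h : IsWordLaw m) (a b : EnvLetter) :
    word₂ m a b = ∑ x, word₃ m x a b := by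
  rw [word₂]
  simp only [h.word₃_eq a b]
  exact Finset.sum_comm

theorem IsWordLaw.word₂_rev (h : IsWordLaw m) (a b : EnvLetter) : word₂ m a b = word₂ m b a := by
  rw [h.word₂_eq]
  exact Finset.sum_congr rfl fun x _ => h.word₃_rev _ _ _

theorem Evolves.word₂_eq (h : Evolves m m' p q r) (x y : EnvLetter) :
    word₂ m' x y = ∑ a, ∑ b, ∑ c,
      gMatrix p q r a b x * gMatrix p q r b c y * word₃ m a b c := by
  have key : ∀ a b c d, ∑ z, gMatrix p q r a b x * gMatrix p q r b c y * gMatrix p q r c d z *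
      m a b c d = gMatrix p q r a b x * gMatrix p q r b c y * m a b c d := by
    intro a b c d
    rw [← Finset.sum_mul, ← Finset.mul_sum, gMatrix_sum, mul_one]
  rw [word₂]
  simp only [h x y]
  simp only [word₃, Finset.mul_sum]
  rw [Finset.sum_comm]
  refine Finset.sum_congr rfl fun a _ => ?_
  rw [Finset.sum_comm]
  refine Finset.sum_congr rfl fun b _ => ?_
  rw [Finset.sum_comm]
  refine Finset.sum_congr rfl fun c _ => ?_
  rw [Finset.sum_comm]
  exact Finset.sum_congr rfl fun d _ => key a b c d

theorem Evolves.word₁_eq (h : Evolves m m' p q r) (x : EnvLetter) :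
    word₁ m' x = ∑ a, ∑ b, gMatrix p q r a b x * word₂ m a b := by
  have key : ∀ a b c, ∑ y, gMatrix p q r a b x * gMatrix p q r b c y * word₃ m a b c =
      gMatrix p q r a b x * word₃ m a b c := by
    intro a b c
    rw [← Finset.sum_mul, ← Finset.mul_sum, gMatrix_sum, mul_one]
  rw [word₁]
  simp only [h.word₂_eq x]
  simp only [word₂, Finset.mul_sum]
  rw [Finset.sum_comm]
  refine Finset.sum_congr rfl fun a _ => ?_
  rw [Finset.sum_comm]
  refine Finset.sum_congr rfl fun b _ => ?_
  rw [Finset.sum_comm]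
  exact Finset.sum_congr rfl fun c _ => key a b c

open EnvLetter

theorem IsWordLaw.word₁_D (hm : IsWordLaw m) :
    word₁ m D = word₂ m W D + word₂ m L D + word₂ m D D := by
  rw [word₁, EnvLetter.sum_eq, hm.word₂_rev D W, hm.word₂_rev D L]

theorem Evolves.word₁_D (h : Evolves m m' p q r) (hm : IsWordLaw m) :
    word₁ m' D = (1 - p - q) * (1 - r) * (2 * word₂ m W D + 2 * r * word₂ m L D +
      (1 + r) * word₂ m D D) := by
  rw [h.word₁_eq]
  simp only [EnvLetter.sum_eq, gMatrix, hm.word₂_rev D W, hm.word₂_rev D L]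
  ring

/-- A cell becomes `W` with probability `p` whatever its neighbours, which gives the term `p * word₁
m' D`. The excess over `p` is present only when a neighbour is `L`, and together with the `D` factor
it contributes `(1 - p - q)² (1 - r)²`. -/
theorem Evolves.word₂_WD (h : Evolves m m' p q r) (hm : IsWordLaw m) :
    word₂ m' W D = p * word₁ m' D + (1 - p - q) ^ 2 * (1 - r) ^ 2 *
      (word₃ m L W D + word₃ m L D W + (1 + r) * word₃ m L D D + r * word₃ m L D L +
        r * word₃ m W L D + r * word₃ m D L D + r * (1 + r) * word₃ m L L D) := by
  have h₁ : word₁ m' D = ∑ b, ∑ c, gMatrix p q r b c D * ∑ a, word₃ m a b c := by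
    rw [h.word₁_eq]
    simp only [hm.word₂_eq]
  rw [h.word₂_eq, h₁]
  simp only [EnvLetter.sum_eq, gMatrix]
  ring

theorem Evolves.word₂_DD (h : Evolves m m' p q r) (hm : IsWordLaw m) :
    word₂ m' D D = (1 - p - q) ^ 2 * (1 - r) ^ 2 *
      (word₃ m W D W + word₃ m D W D + 2 * (1 + r) * word₃ m W D D +
        (1 + r) ^ 2 * word₃ m D D D + 2 * r * word₃ m L D W + 2 * r * (1 + r) * word₃ m L D D +
        r ^ 2 * word₃ m L D L + r ^ 2 * word₃ m D L D) := by
  rw [h.word₂_eq]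
  simp only [EnvLetter.sum_eq, gMatrix, hm.word₃_rev D D W, hm.word₃_rev W D L,
    hm.word₃_rev D D L]
  ring

/-- The probability of becoming `L` is at most `q + (1 - p - q) r`, except above `WW`, where it is
larger by exactly `(1 - p - q)(1 - r)`. The exception is charged to the parent words that begin with
`WW`. -/
theorem Evolves.word₃_LWD_le (h : Evolves m m' p q r) (hm : IsWordLaw m) (hΘ : (p, q, r) ∈ Theta) :
    word₃ m' L W D ≤ (q + (1 - p - q) * r) * word₂ m' W D + (1 - p - q) ^ 2 * (1 - r) ^ 2 *
      (p * (m W W W D + m W W D W + r * m W W D L + (1 + r) * m W W D D + r * m W W L D) +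
        (1 - p - q) * (1 - r) * r * m W W L D) := by
  have hL : ∀ a b, gMatrix p q r a b L ≤ (q + (1 - p - q) * r) +
      if a = W ∧ b = W then (1 - p - q) * (1 - r) else 0 := by
    obtain ⟨⟨hp, hp'⟩, ⟨hq, hq'⟩, ⟨hr, hr'⟩, -, hpq⟩ := hΘ
    simp only at hp hp' hq hq' hr hr' hpq
    have h1 : 0 ≤ 1 - p - q := by linarith
    have h2 : (1 - p - q) * r ^ 2 ≤ (1 - p - q) * r :=
      mul_le_mul_of_nonneg_left (by nlinarith) h1
    intro a b
    cases a <;> cases b <;> simp [gMatrix] <;> linarith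
  have h₂ : word₂ m' W D = ∑ a, ∑ b, ∑ c, ∑ d,
      gMatrix p q r b c W * gMatrix p q r c d D * m a b c d := by
    rw [h.word₂_eq]
    simp only [hm.word₃_eq, Finset.mul_sum]
    symm
    rw [Finset.sum_comm]
    refine Finset.sum_congr rfl fun b _ => ?_
    rw [Finset.sum_comm]
    refine Finset.sum_congr rfl fun c _ => ?_
    exact Finset.sum_comm
  rw [h L W D, h₂]
  calc _ ≤ ∑ a, ∑ b, ∑ c, ∑ d, ((q + (1 - p - q) * r) +
      if a = W ∧ b = W then (1 - p - q) * (1 - r) else 0) * gMatrix p q r b c W *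
        gMatrix p q r c d D * m a b c d := by
        gcongr with a _ b _ c _ d _
        · exact hm.nonneg _ _ _ _
        · exact gMatrix_nonneg hΘ _ _ _
        · exact gMatrix_nonneg hΘ _ _ _
        · exact hL a b
    _ = (q + (1 - p - q) * r) * ∑ a, ∑ b, ∑ c, ∑ d,
          gMatrix p q r b c W * gMatrix p q r c d D * m a b c d + ∑ c, ∑ d,
          (1 - p - q) * (1 - r) * gMatrix p q r W c W * gMatrix p q r c d D * m W W c d := by
        simp only [add_mul, Finset.sum_add_distrib, Finset.mul_sum, mul_assoc, ite_and, ite_mul,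
          zero_mul, Finset.sum_ite_irrel, Finset.sum_const_zero, Finset.sum_ite_eq',
          Finset.mem_univ, if_true]
    _ = _ := by
        congr 1
        simp only [EnvLetter.sum_eq, gMatrix]
        ring

/-- Only parents with `DD` in the middle and no `L` at the ends are kept: their middle cell becomes
`W` with probability `p`, and each outer cell becomes `D` with probability at least `(1 - p - q)(1 -
r)`. -/
theorem Evolves.word₃_DWD_ge (h : Evolves m m' p q r) (hm : IsWordLaw m) (hΘ : (p, q, r) ∈ Theta) :
    p * ((1 - p - q) ^ 2 * (1 - r) ^ 2) * (word₂ m D D - 2 * word₃ m L D D) ≤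
      word₃ m' D W D := by
  have h0 : ∀ a b c d, 0 ≤ gMatrix p q r a b D * gMatrix p q r b c W * gMatrix p q r c d D *
      m a b c d := fun a b c d => mul_nonneg (mul_nonneg (mul_nonneg (gMatrix_nonneg hΘ _ _ _)
        (gMatrix_nonneg hΘ _ _ _)) (gMatrix_nonneg hΘ _ _ _)) (hm.nonneg _ _ _ _)
  -- By reflection, `2 * word₃ m L D D` removes the words with an `L` at either end, and `LDDL`
  -- twice.
  have hDD : word₂ m D D - 2 * word₃ m L D D ≤
      m W D D W + m W D D D + m D D D W + m D D D D := by
    have h1 : word₂ m D D = ∑ a, ∑ d, m a D D d := hm.word₂_eq D D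
    have h2 : word₃ m L D D = ∑ d, m L D D d := rfl
    rw [h1, h2]
    simp only [EnvLetter.sum_eq]
    linarith [hm.rev L D D W, hm.rev L D D D, hm.nonneg L D D L]
  obtain ⟨⟨hp, -⟩, -, ⟨hr, hr'⟩, -, hpq⟩ := id hΘ
  simp only at hp hr hr' hpq
  have hc : 0 ≤ p * ((1 - p - q) ^ 2 * (1 - r) ^ 2) := by positivity
  calc _ ≤ p * ((1 - p - q) ^ 2 * (1 - r) ^ 2) *
        (m W D D W + m W D D D + m D D D W + m D D D D) := mul_le_mul_of_nonneg_left hDD hc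
    _ ≤ p * ((1 - p - q) ^ 2 * (1 - r) ^ 2) * (m W D D W + (1 + r) * m W D D D +
        (1 + r) * m D D D W + (1 + r) ^ 2 * m D D D D) := by
        refine mul_le_mul_of_nonneg_left ?_ hc
        nlinarith [mul_nonneg hr (hm.nonneg W D D D), mul_nonneg hr (hm.nonneg D D D W),
          mul_nonneg hr (hm.nonneg D D D D), mul_nonneg (mul_nonneg hr hr) (hm.nonneg D D D D)]
    _ = ∑ a ∈ {W, D}, ∑ d ∈ {W, D}, gMatrix p q r a D D * gMatrix p q r D D W *
          gMatrix p q r D d D * m a D D d := by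
        simp only [Finset.sum_pair (show W ≠ D by decide), gMatrix]
        ring
    _ ≤ ∑ a, ∑ d, gMatrix p q r a D D * gMatrix p q r D D W *
          gMatrix p q r D d D * m a D D d := by
        refine (Finset.sum_le_sum fun a _ => Finset.sum_le_univ_sum_of_nonneg fun d =>
          h0 a D D d).trans (Finset.sum_le_univ_sum_of_nonneg fun a =>
            Finset.sum_nonneg fun d _ => h0 a D D d)
    _ ≤ _ := by
        rw [h D W D]
        refine Finset.sum_le_sum fun a _ => ?_
        refine le_trans ?_ (Finset.single_le_sum (f := fun b => ∑ c, ∑ d, gMatrix p q r a b D *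
          gMatrix p q r b c W * gMatrix p q r c d D * m a b c d) (fun b _ =>
          Finset.sum_nonneg fun c _ => Finset.sum_nonneg fun d _ => h0 a b c d)
          (Finset.mem_univ D))
        exact Finset.single_le_sum (f := fun c => ∑ d, gMatrix p q r a D D *
          gMatrix p q r D c W * gMatrix p q r c d D * m a D c d) (fun c _ =>
          Finset.sum_nonneg fun d _ => h0 a D c d) (Finset.mem_univ D)

/-! ### The decreasing potential. -/

/-- The potential of a word law. -/
def potential (A B C g : ℝ) (m : EnvLetter → EnvLetter → EnvLetter → EnvLetter → ℝ) : ℝ :=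
  word₁ m D + A * word₂ m W D + B * word₃ m L W D - g * word₃ m D W D - C * word₂ m D D

/-- The conditions on the coefficients of a potential under which one update decreases it by at
least `κ` times the density of undecided cells. The slack variable `x` is the part of the loss on
`LDD` that is charged to `DD`; `y` and `z` bound the losses charged to `LD` from the right and from
the left. -/
structure IsAdmissible (p q r A B C g κ x y z : ℝ) : Prop where
  B_nonneg : 0 ≤ B
  C_nonneg : 0 ≤ C
  g_nonneg : 0 ≤ g
  S_nonneg : 0 ≤ A + B * (q + (1 - p - q) * r)
  WD : κ ≤ 1 - (1 - p - q) * (1 - r) * (1 + r) * (1 + p * (A + B * (q + (1 - p - q) * r))) + A -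
    (1 - p - q) * (1 - r) ^ 2 * (1 + p * (A + B * (q + (1 - p - q) * r))) -
    (2 + r) * B * p * ((1 - p - q) ^ 2 * (1 - r) ^ 2) + C * ((1 - p - q) ^ 2 * (1 - r) ^ 2)
  DWD : g ≤ (2 + r) * B * p * ((1 - p - q) ^ 2 * (1 - r) ^ 2) +
    C * ((1 - p - q) ^ 2 * (1 - r) ^ 2)
  LWD : (A + B * (q + (1 - p - q) * r)) * ((1 - p - q) ^ 2 * (1 - r) ^ 2) ≤
    B + (2 + r) * B * p * ((1 - p - q) ^ 2 * (1 - r) ^ 2)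
  DD : κ ≤ 1 - (1 - p - q) * (1 - r) * (1 + r) * (1 + p * (A + B * (q + (1 - p - q) * r))) +
    g * p * ((1 - p - q) ^ 2 * (1 - r) ^ 2) - C +
    C * ((1 - p - q) ^ 2 * (1 - r) ^ 2) * (1 + r) ^ 2 - x
  WDD : C * ((1 - p - q) ^ 2 * (1 - r) ^ 2) * r ^ 2 ≤ x
  y_nonneg : 0 ≤ y
  LDD : (A + B * (q + (1 - p - q) * r)) * ((1 - p - q) ^ 2 * (1 - r) ^ 2) * r +
    2 * g * p * ((1 - p - q) ^ 2 * (1 - r) ^ 2) +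
    C * ((1 - p - q) ^ 2 * (1 - r) ^ 2) * (1 - r ^ 2) - x ≤ y
  LDW : C * ((1 - p - q) ^ 2 * (1 - r) ^ 2) * (1 - 2 * r) ≤ y
  z_nonneg : 0 ≤ z
  WWLD : B * r * ((1 - p - q) ^ 3 * (1 - r) ^ 3) + B * p * ((1 - p - q) ^ 2 * (1 - r) ^ 2) * r ≤ z
  LLD : (A + B * (q + (1 - p - q) * r)) * ((1 - p - q) ^ 2 * (1 - r) ^ 2) * r ^ 2 ≤ z
  LD : κ ≤ 1 - (1 - p - q) * (1 - r) * (1 + r) * (1 + p * (A + B * (q + (1 - p - q) * r))) +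
    (1 - p - q) * (1 - r) ^ 2 * (1 + p * (A + B * (q + (1 - p - q) * r))) -
    (A + B * (q + (1 - p - q) * r)) * ((1 - p - q) ^ 2 * (1 - r) ^ 2) * (1 + r) - y - z

theorem Evolves.potential_le {A B C g κ x y z : ℝ} (h : Evolves m m' p q r) (hm : IsWordLaw m)
    (hΘ : (p, q, r) ∈ Theta) (hc : IsAdmissible p q r A B C g κ x y z) :
    potential A B C g m' ≤ potential A B C g m - κ * word₁ m D := by
  have eD' := h.word₁_D hm
  have eWD' := h.word₂_WD hm
  have eDD' := h.word₂_DD hm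
  have bLWD' := mul_le_mul_of_nonneg_left (h.word₃_LWD_le hm hΘ) hc.B_nonneg
  have bDWD' := mul_le_mul_of_nonneg_left (h.word₃_DWD_ge hm hΘ) hc.g_nonneg
  have eD := hm.word₁_D
  obtain ⟨⟨hp, -⟩, -, ⟨hr, hr'⟩, -, hpq⟩ := id hΘ
  simp only at hp hr hr' hpq
  have eWD : word₂ m W D = word₃ m W W D + word₃ m L W D + word₃ m D W D := by
    rw [hm.word₂_eq, EnvLetter.sum_eq]
  have eWD₂ : word₂ m W D = word₃ m W D W + word₃ m L D W + word₃ m W D D := by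
    rw [word₂, EnvLetter.sum_eq, hm.word₃_rev W D L]
  have eLD : word₂ m L D = word₃ m W L D + word₃ m L L D + word₃ m D L D := by
    rw [hm.word₂_eq, EnvLetter.sum_eq]
  have eLD₂ : word₂ m L D = word₃ m L D W + word₃ m L D L + word₃ m L D D := by
    rw [word₂, EnvLetter.sum_eq]
  have eDD : word₂ m D D = word₃ m W D D + word₃ m L D D + word₃ m D D D := by
    rw [hm.word₂_eq, EnvLetter.sum_eq]
  have eWWD : word₃ m W W D = m W W D W + m W W D L + m W W D D := by
    rw [word₃, EnvLetter.sum_eq]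
  have lWWD : m W W W D ≤ word₃ m W W D := by
    rw [hm.word₃_eq, EnvLetter.sum_eq]
    linarith [hm.nonneg L W W D, hm.nonneg D W W D]
  have lWLD : m W W L D ≤ word₃ m W L D := by
    rw [hm.word₃_eq, EnvLetter.sum_eq]
    linarith [hm.nonneg L W L D, hm.nonneg D W L D]
  have nWWWD := hm.nonneg W W W D
  have nWWDW := hm.nonneg W W D W
  have nWWDL := hm.nonneg W W D L
  have nWWDD := hm.nonneg W W D D
  have nWWLD := hm.nonneg W W L D
  have n₃ := hm.word₃_nonneg
  have n₂ := hm.word₂_nonneg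
  have hB := hc.B_nonneg
  have hC := hc.C_nonneg
  have hS := hc.S_nonneg
  -- Each inequality of `IsAdmissible` is weighted by the probability of its word. The slacks
  -- telescope through the marginal identities: `x` on `DD` pays for `WDD`, `LDD` and `DDD`, while
  -- `y` and `z` on `LD` pay for its extensions to the right and to the left.
  have kWD := mul_le_mul_of_nonneg_right hc.WD (n₂ W D)
  have kDWD := mul_le_mul_of_nonneg_right hc.DWD (n₃ D W D)
  have kLWD := mul_le_mul_of_nonneg_right hc.LWD (n₃ L W D)
  have kDD := mul_le_mul_of_nonneg_right hc.DD (n₂ D D)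
  have kWDD := mul_le_mul_of_nonneg_right hc.WDD (n₃ W D D)
  have kLDD := mul_le_mul_of_nonneg_right hc.LDD (n₃ L D D)
  have kLDW := mul_le_mul_of_nonneg_right hc.LDW (n₃ L D W)
  have kLDL := mul_nonneg hc.y_nonneg (n₃ L D L)
  have kWLD := mul_le_mul_of_nonneg_right hc.WWLD nWWLD
  have kWLD' := mul_le_mul_of_nonneg_left lWLD hc.z_nonneg
  have kLLD := mul_le_mul_of_nonneg_right hc.LLD (n₃ L L D)
  have kDLD := mul_nonneg hc.z_nonneg (n₃ D L D)
  have kLD := mul_le_mul_of_nonneg_right hc.LD (n₂ L D)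
  have hx : 0 ≤ x := le_trans (by positivity) hc.WDD
  have kDDD := mul_nonneg hx (n₃ D D D)
  have kSum : A * word₂ m' W D + B * word₃ m' L W D ≤
      (A + B * (q + (1 - p - q) * r)) * word₂ m' W D + B * ((1 - p - q) ^ 2 * (1 - r) ^ 2) *
      (p * (m W W W D + m W W D W + r * m W W D L + (1 + r) * m W W D D + r * m W W L D)) +
        B * r * ((1 - p - q) ^ 3 * (1 - r) ^ 3) * m W W L D := by
    linear_combination bLWD'
  clear bLWD'
  have ho : 0 ≤ 1 - p - q := by linarith
  have hf : (1 - p - q) ^ 3 * (1 - r) ^ 3 = (1 - p - q) * (1 - r) *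
    ((1 - p - q) ^ 2 * (1 - r) ^ 2) := by ring
  have he : 0 ≤ (1 - p - q) ^ 2 * (1 - r) ^ 2 := by positivity
  rw [hf] at kSum kWLD
  generalize (1 - p - q) ^ 2 * (1 - r) ^ 2 = e at *
  generalize A + B * (q + (1 - p - q) * r) = S at *
  generalize 1 - p - q = o at *

  have hBpe : 0 ≤ B * p * e := by positivity
  have hBper : 0 ≤ B * p * e * r := by positivity
  have hSe : 0 ≤ S * e * (1 - r) := mul_nonneg (by positivity) (by linarith)
  have hCe : 0 ≤ C * e * r ^ 2 := by positivity
  -- Source of the factor `2 + r`: `WWWD` costs at most one `WWD`, and the right extensions of `WWD`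
  -- cost at most `1 + r` times `WWD`. Then `WWD` is rewritten as `WD - LWD - DWD`.
  have s₁ := mul_nonneg hBpe (sub_nonneg.2 lWWD)
  have s₂ := mul_nonneg hBpe nWWDL
  have s₃ := mul_nonneg hBper nWWDW
  have s₄ := mul_nonneg hSe (n₃ L D L)
  have s₅ := mul_nonneg hCe (n₃ L D L)
  have s₆ := mul_nonneg hCe (n₃ D L D)
  have hD' : word₁ m' D * (1 + p * S) = o * (1 - r) * (1 + p * S) * (2 * word₂ m W D +
      2 * r * word₂ m L D + (1 + r) * word₂ m D D) := by
    rw [eD']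
    ring
  have eDDD : word₃ m D D D = word₂ m D D - word₃ m W D D - word₃ m L D D := by linarith
  have eDWD : word₃ m D W D = word₂ m W D - word₃ m W W D - word₃ m L W D := by linarith
  have eWDW : word₃ m W D W = word₂ m W D - word₃ m L D W - word₃ m W D D := by linarith
  have eDLD : word₃ m D L D = word₂ m L D - word₃ m W L D - word₃ m L L D := by linarith
  have eLDL : word₃ m L D L = word₂ m L D - word₃ m L D W - word₃ m L D D := by linarith
  have eWWDW : m W W D W = word₃ m W W D - m W W D L - m W W D D := by linarith
  simp only [potential, eD, eDD', eWD', eDDD, eWDW, eDWD, eDLD, eLDL, eWWDW] at *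
  linarith

end Words

/-! ### From the evolving law to word laws, and decay of undecided cells. -/

open EnvLetter

theorem sum_real_inter_eval (μ : Measure (ℤ → EnvLetter)) [IsFiniteMeasure μ]
    {s : Set (ℤ → EnvLetter)} (hs : MeasurableSet s) (k : ℤ) :
    ∑ x, μ.real (s ∩ {η | η k = x}) = μ.real s := by
  rw [← measureReal_biUnion_finset]
  · congr 1
    ext η
    simp
  · intro x _ y _ hxy
    refine Set.disjoint_left.2 fun η hx hy => hxy ?_
    exact hx.2.symm.trans hy.2
  · exact fun x _ => hs.inter (measurableSet_eval_eq k x)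

/-- The probability of a word of length four at the origin. -/
noncomputable def wordProb (μ : Measure (ℤ → EnvLetter)) (a b c d : EnvLetter) : ℝ :=
  μ.real {η | η 0 = a ∧ η 1 = b ∧ η 2 = c ∧ η 3 = d}

/-- The probability of a word of length four at the origin, averaged with that of its reversal. -/
noncomputable def symWordProb (μ : Measure (ℤ → EnvLetter)) (a b c d : EnvLetter) : ℝ :=
  (wordProb μ a b c d + wordProb μ d c b a) / 2

theorem measurableSet_word₂ (i j : ℤ) (a b : EnvLetter) :
    MeasurableSet {η : ℤ → EnvLetter | η i = a ∧ η j = b} :=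
  (measurableSet_eval_eq i a).inter (measurableSet_eval_eq j b)

theorem measurableSet_word₃ (i j k : ℤ) (a b c : EnvLetter) :
    MeasurableSet {η : ℤ → EnvLetter | η i = a ∧ η j = b ∧ η k = c} :=
  (measurableSet_eval_eq i a).inter (measurableSet_word₂ j k b c)

section

variable {μ : Measure (ℤ → EnvLetter)} [IsFiniteMeasure μ]

theorem sum_wordProb_right (a b c : EnvLetter) :
    ∑ x, wordProb μ a b c x = μ.real {η | η 0 = a ∧ η 1 = b ∧ η 2 = c} := by
  rw [← sum_real_inter_eval μ (measurableSet_word₃ 0 1 2 a b c) 3]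
  refine Finset.sum_congr rfl fun x _ => congrArg μ.real ?_
  ext η
  simp [and_assoc]

theorem sum_wordProb_left (hμ : μ.map shift = μ) (a b c : EnvLetter) :
    ∑ x, wordProb μ x a b c = μ.real {η | η 0 = a ∧ η 1 = b ∧ η 2 = c} := by
  have h : μ.real {η | η 0 = a ∧ η 1 = b ∧ η 2 = c} =
      μ.real {η | η 1 = a ∧ η 2 = b ∧ η 3 = c} := by
    conv_lhs => rw [← hμ, map_measureReal_apply measurable_shift (measurableSet_word₃ 0 1 2 a b c)]
    rfl
  rw [h, ← sum_real_inter_eval μ (measurableSet_word₃ 1 2 3 a b c) 0]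
  refine Finset.sum_congr rfl fun x _ => congrArg μ.real ?_
  ext η
  simp only [Set.mem_ofPred_eq, Set.mem_inter_iff]
  tauto

theorem isWordLaw_symWordProb (hμ : μ.map shift = μ) : IsWordLaw (symWordProb μ) where
  nonneg a b c d := div_nonneg (add_nonneg measureReal_nonneg measureReal_nonneg) zero_le_two
  rev a b c d := by rw [symWordProb, symWordProb, add_comm]
  shift a b c := by
    simp only [symWordProb, ← Finset.sum_div, Finset.sum_add_distrib, sum_wordProb_right,
      sum_wordProb_left hμ]

theorem word₃_symWordProb (hμ : μ.map shift = μ) (a b c : EnvLetter) :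
    word₃ (symWordProb μ) a b c = (μ.real {η | η 0 = a ∧ η 1 = b ∧ η 2 = c} +
      μ.real {η | η 0 = c ∧ η 1 = b ∧ η 2 = a}) / 2 := by
  simp only [word₃, symWordProb, ← Finset.sum_div, Finset.sum_add_distrib, sum_wordProb_right,
    sum_wordProb_left hμ]

theorem word₁_symWordProb (hμ : μ.map shift = μ) (a : EnvLetter) :
    word₁ (symWordProb μ) a = μ.real {η | η 0 = a} := by
  have h₀ : ∑ b, ∑ c, μ.real {η | η 0 = a ∧ η 1 = b ∧ η 2 = c} = μ.real {η | η 0 = a} := by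
    rw [← sum_real_inter_eval μ (measurableSet_eval_eq 0 a) 1]
    refine Finset.sum_congr rfl fun b _ => ?_
    rw [← sum_real_inter_eval μ ((measurableSet_eval_eq 0 a).inter (measurableSet_eval_eq 1 b)) 2]
    refine Finset.sum_congr rfl fun c _ => congrArg μ.real ?_
    ext η
    simp [and_assoc]
  have h₂ : ∑ b, ∑ c, μ.real {η | η 0 = c ∧ η 1 = b ∧ η 2 = a} = μ.real {η | η 2 = a} := by
    rw [← sum_real_inter_eval μ (measurableSet_eval_eq 2 a) 1]
    refine Finset.sum_congr rfl fun b _ => ?_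
    rw [← sum_real_inter_eval μ ((measurableSet_eval_eq 2 a).inter (measurableSet_eval_eq 1 b)) 0]
    refine Finset.sum_congr rfl fun c _ => congrArg μ.real ?_
    ext η
    simp only [Set.mem_ofPred_eq, Set.mem_inter_iff]
    tauto
  have hs : ∀ k, μ.real {η | η k = a} = μ.real {η | η (k + 1) = a} := by
    intro k
    conv_lhs => rw [← hμ, map_measureReal_apply measurable_shift (measurableSet_eval_eq k a)]
    rfl
  have h₀₂ : μ.real {η | η 0 = a} = μ.real {η | η 2 = a} := (hs 0).trans (hs (0 + 1))
  simp only [word₁, word₂, word₃_symWordProb hμ, ← Finset.sum_div, Finset.sum_add_distrib, h₀, h₂,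
    ← h₀₂]
  ring

end

theorem gMatrix_comm (p q r : ℝ) (a₀ a₁ b : EnvLetter) :
    gMatrix p q r a₀ a₁ b = gMatrix p q r a₁ a₀ b := by
  cases a₀ <;> cases a₁ <;> cases b <;> rfl

theorem step_real_word₃ {p q r : ℝ} (h : (p, q, r) ∈ Theta)
    (μ : ProbabilityMeasure (ℤ → EnvLetter)) (x y z : EnvLetter) :
    ((GHat p q r h).step μ : Measure (ℤ → EnvLetter)).real {η | η 0 = x ∧ η 1 = y ∧ η 2 = z} =
      ∑ a, ∑ b, ∑ c, ∑ d, gMatrix p q r a b x * gMatrix p q r b c y * gMatrix p q r c d z *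
        wordProb μ a b c d := by
  have hset : {η : ℤ → EnvLetter | η 0 = x ∧ η 1 = y ∧ η 2 = z} =
      cyl {0, 1, 2} fun i => if i = 0 then x else if i = 1 then y else z := by
    ext η
    simp [cyl]
  have hmeas : Measurable fun η : ℤ → EnvLetter => (η 0, η 1, η 2, η 3) := by fun_prop
  have := integral_comp_eq_sum (μ := (μ : Measure (ℤ → EnvLetter))) hmeas
    fun v => gMatrix p q r v.1 v.2.1 x * gMatrix p q r v.2.1 v.2.2.1 y *
      gMatrix p q r v.2.2.1 v.2.2.2 z
  rw [hset, step_cyl]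
  simp only [Fintype.sum_prod_type] at this
  convert this using 2
  · ext η
    simp [GHat, mul_assoc]
  · simp only [wordProb]
    congr! 9
    ext η
    simp

/-- The matrix is symmetric in its two neighbours, so reversing words commutes with the update. As
the evolution of word probabilities is linear, averaging with the reversal is preserved, and
reflection invariance of the law itself need not be proved. -/
theorem evolves_symWordProb {p q r : ℝ} (h : (p, q, r) ∈ Theta)
    {μ : ProbabilityMeasure (ℤ → EnvLetter)}
    (hμ' : ((GHat p q r h).step μ : Measure (ℤ → EnvLetter)).map shift =
      (GHat p q r h).step μ) :
    Evolves (symWordProb μ) (symWordProb ((GHat p q r h).step μ)) p q r := by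
  intro x y z
  have hrev : ∑ a, ∑ b, ∑ c, ∑ d, gMatrix p q r a b z * gMatrix p q r b c y *
      gMatrix p q r c d x * wordProb μ a b c d = ∑ a, ∑ b, ∑ c, ∑ d, gMatrix p q r a b x *
      gMatrix p q r b c y * gMatrix p q r c d z * wordProb μ d c b a := by
    have hswap : ∀ f : EnvLetter → EnvLetter → EnvLetter → EnvLetter → ℝ,
        ∑ a, ∑ b, ∑ c, ∑ d, f a b c d = ∑ a, ∑ b, ∑ c, ∑ d, f d c b a := by
      intro f
      simp only [EnvLetter.sum_eq]
      ring
    rw [hswap]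
    refine Finset.sum_congr rfl fun a _ => Finset.sum_congr rfl fun b _ =>
      Finset.sum_congr rfl fun c _ => Finset.sum_congr rfl fun d _ => ?_
    rw [gMatrix_comm p q r d c, gMatrix_comm p q r c b, gMatrix_comm p q r b a]
    ring
  rw [word₃_symWordProb hμ', step_real_word₃, step_real_word₃, hrev]
  simp only [← Finset.sum_add_distrib, Finset.sum_div, symWordProb]
  refine Finset.sum_congr rfl fun a _ => Finset.sum_congr rfl fun b _ =>
    Finset.sum_congr rfl fun c _ => Finset.sum_congr rfl fun d _ => ?_
  ring

/-- The lower bound that turns the decrease of the potential into summability: each word in it has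
probability at most that of `D`. -/
theorem IsWordLaw.neg_le_potential {m : EnvLetter → EnvLetter → EnvLetter → EnvLetter → ℝ}
    (hm : IsWordLaw m) (h1 : word₁ m .D ≤ 1) (A B C g : ℝ) :
    -(|A| + |B| + |C| + |g|) ≤ potential A B C g m := by
  have eD := hm.word₁_D
  have n₂ := hm.word₂_nonneg
  have n₃ := hm.word₃_nonneg
  have eWD : word₂ m .W .D = word₃ m .W .W .D + word₃ m .L .W .D + word₃ m .D .W .D := by
    rw [hm.word₂_eq, EnvLetter.sum_eq]
  have key : ∀ c v : ℝ, 0 ≤ v → v ≤ 1 → |c * v| ≤ |c| := by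
    intro c v hv hv'
    rw [abs_mul, abs_of_nonneg hv]
    exact mul_le_of_le_one_right (abs_nonneg c) hv'
  have b₁ := abs_le.1 (key A (word₂ m .W .D) (n₂ _ _) (by linarith [n₂ .L .D, n₂ .D .D]))
  have b₂ := abs_le.1 (key B (word₃ m .L .W .D) (n₃ _ _ _)
    (by linarith [n₂ .L .D, n₂ .D .D, n₃ .W .W .D, n₃ .D .W .D]))
  have b₃ := abs_le.1 (key C (word₂ m .D .D) (n₂ _ _) (by linarith [n₂ .L .D, n₂ .W .D]))
  have b₄ := abs_le.1 (key g (word₃ m .D .W .D) (n₃ _ _ _)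
    (by linarith [n₂ .L .D, n₂ .D .D, n₃ .W .W .D, n₃ .L .W .D]))
  have := hm.word₁_nonneg .D
  rw [potential]
  linarith [b₁.1, b₂.1, b₃.2, b₄.2]

theorem tendsto_zero_of_isAdmissible {p q r A B C g κ x y z : ℝ} (h : (p, q, r) ∈ Theta)
    (hκ : 0 < κ) (hc : IsAdmissible p q r A B C g κ x y z) :
    Tendsto (fun t => ((GHat p q r h).step^[t] undecided : Measure (ℤ → EnvLetter)).real
      {η | η 0 = .D}) atTop (𝓝 0) := by
  set m : ℕ → EnvLetter → EnvLetter → EnvLetter → EnvLetter → ℝ := fun t =>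
    symWordProb ((GHat p q r h).step^[t] undecided : Measure (ℤ → EnvLetter)) with hm_def
  have hinv := map_shift_iterate_undecided h
  have hm : ∀ t, IsWordLaw (m t) := fun t => isWordLaw_symWordProb (hinv t)
  have hD : ∀ t, ((GHat p q r h).step^[t] undecided : Measure (ℤ → EnvLetter)).real
      {η | η 0 = .D} = word₁ (m t) .D := fun t => (word₁_symWordProb (hinv t) _).symm
  have hD1 : ∀ t, word₁ (m t) .D ≤ 1 := fun t => hD t ▸ measureReal_le_one
  have hev : ∀ t, Evolves (m t) (m (t + 1)) p q r := by
    intro t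
    have := hinv (t + 1)
    simp only [hm_def, Function.iterate_succ_apply'] at this ⊢
    exact evolves_symWordProb h this
  have hsum : ∀ n, κ * ∑ t ∈ Finset.range n, word₁ (m t) .D ≤
      potential A B C g (m 0) - potential A B C g (m n) := by
    intro n
    induction n with
    | zero => simp
    | succ n ih =>
      rw [Finset.sum_range_succ, mul_add]
      linarith [(hev n).potential_le (hm n) h hc]
  simp only [hD]
  refine (summable_of_sum_range_le (c := (potential A B C g (m 0) + (|A| + |B| + |C| + |g|)) / κ)
    (fun t => (hm t).word₁_nonneg _) fun n => ?_).tendsto_atTop_zero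
  rw [le_div_iff₀ hκ, mul_comm]
  linarith [hsum n, (hm n).neg_le_potential (hD1 n) A B C g]

theorem isErgodic_of_isAdmissible {p q r A B C g κ x y z : ℝ} (h : (p, q, r) ∈ Theta)
    (hκ : 0 < κ) (hc : IsAdmissible p q r A B C g κ x y z) :
    (G p q r h).IsErgodic ∧ (GHat p q r h).IsErgodic :=
  isErgodic_of_undecided_tendsto_zero h (tendsto_zero_of_isAdmissible h hκ hc)

/-! ### Explicit admissible coefficients, regime by regime. -/

set_option maxHeartbeats 1600000 in
/-- Admissible coefficients for the regime of small parameters. -/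
theorem isAdmissible_small {p q r : ℝ} (hp : 0 ≤ p) (hq : 0 ≤ q) (hr : 0 ≤ r)
    (hp' : p ≤ 1 / 1000) (hq' : q ≤ 1 / 1000) (hr' : r ≤ 17 / 10 * q + 4 / 5 * p ^ 2) :
    ∃ A B g x y z, IsAdmissible p q r A B 0 g ((q + p ^ 2) / 100) x y z := by
  -- All margins are measured on the scale `σ`: `q`, `r` and `p²` are at most constant multiples of
  -- `σ`, and products with one more small factor are negligible multiples of it.
  obtain ⟨σ, hσ⟩ : ∃ σ, σ = q + p ^ 2 := ⟨_, rfl⟩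
  have hp2 : 0 ≤ p ^ 2 := sq_nonneg p
  have hσ0 : 0 ≤ σ := by linarith
  have hqσ : q ≤ σ := by linarith
  have hpσ : p ^ 2 ≤ σ := by linarith
  have hrσ : r ≤ 17 / 10 * σ := by linarith
  have hp2' : p ^ 2 ≤ 1 / 1000 * p := by
    rw [sq]
    exact mul_le_mul_of_nonneg_right hp' hp
  have hr1 : r ≤ 1 / 500 := by linarith
  have bound : ∀ a b : ℝ, 0 ≤ a → a ≤ 1 / 500 → 0 ≤ b → b ≤ 17 / 10 * σ →
      0 ≤ a * b ∧ a * b ≤ 17 / 5000 * σ := fun a b ha ha' hb hb' =>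
    ⟨mul_nonneg ha hb, (mul_le_mul ha' hb' hb (by norm_num)).trans_eq (by ring)⟩
  have hpq := bound p q hp (by linarith) hq (by linarith)
  have hpr := bound p r hp (by linarith) hr (by linarith)
  have hqq := bound q q hq (by linarith) hq (by linarith)
  have hqr := bound q r hq (by linarith) hr (by linarith)
  have hrr := bound r r hr hr1 hr (by linarith)
  have hppp := bound p (p ^ 2) hp (by linarith) hp2 (by linarith)
  have hqpp := bound q (p ^ 2) hq (by linarith) hp2 (by linarith)
  have hrpp := bound r (p ^ 2) hr hr1 hp2 (by linarith)
  obtain ⟨L₁, hL₁⟩ : ∃ L₁, L₁ = q + (1 - p - q) * r := ⟨_, rfl⟩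
  have hL₁l : q + r - σ / 100 ≤ L₁ := by rw [hL₁]; linarith [hpr.1, hpr.2, hqr.1, hqr.2]
  have hL₁u : L₁ ≤ q + r := by rw [hL₁]; linarith [hpr.1, hqr.1]
  have hL₁0 : 0 ≤ L₁ := by rw [hL₁]; exact add_nonneg hq (mul_nonneg (by linarith) hr)
  -- Expansions about `A = B = 1` at the origin. The first-order terms in `p` cancel in `WD`, `LWD`
  -- and `LD`, and the second-order terms decide: for instance `WD` keeps about `3/20 q + 3 p²`.
  obtain ⟨A, hA⟩ : ∃ A, A = 1 + 2 * p - 37 / 20 * q - 2 * r - 3 * p ^ 2 := ⟨_, rfl⟩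
  obtain ⟨B, hB⟩ : ∃ B, B = 1 - 2 * p + 3 * p ^ 2 := ⟨_, rfl⟩
  obtain ⟨S, hS⟩ : ∃ S, S = A + B * L₁ := ⟨_, rfl⟩
  have hB0 : 0 ≤ B := by rw [hB]; linarith
  have hB1 : B ≤ 1 := by rw [hB]; linarith
  have hBL := mul_le_mul_of_nonneg_right hB1 hL₁0
  have hS0 : 0 ≤ S := by rw [hS, hA]; linarith [mul_nonneg hB0 hL₁0]
  have hSu : S ≤ 1 + 2 * p - 17 / 20 * q - r - 3 * p ^ 2 := by rw [hS, hA]; linarith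
  have hpS := mul_le_mul_of_nonneg_left hSu hp
  have hT : 1 + p * S ≤ 1 + p + 2 * p ^ 2 := by linarith [hpq.1, hpr.1, hppp.1]
  have hT0 : 0 ≤ 1 + p * S := by positivity
  obtain ⟨M, hM⟩ : ∃ M, M = (1 - p - q) * (1 + p * S) := ⟨_, rfl⟩
  have ho : 0 ≤ 1 - p - q := by linarith
  have ho1 : 1 - p - q ≤ 1 := by linarith
  have hM0 : 0 ≤ M := hM ▸ mul_nonneg ho hT0
  have hMu : M ≤ 1 + p ^ 2 - q := by
    rw [hM]
    linarith [mul_le_mul_of_nonneg_left hT ho, hppp.1, hpq.1, hqpp.1]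
  have hM1 : M ≤ 1001 / 1000 := by linarith
  obtain ⟨E, hE⟩ : ∃ E, E = (1 - p - q) ^ 2 * (1 - r) ^ 2 := ⟨_, rfl⟩
  have hE0 : 0 ≤ E := by rw [hE]; positivity
  have ho2 : (1 - p - q) ^ 2 ≤ 1 - 2 * p - 2 * q + p ^ 2 + σ / 50 := by linarith [hpq.2, hqq.2]
  have ho2l : 1 - 1 / 250 ≤ (1 - p - q) ^ 2 := by
    linarith [hpq.1, hqq.1]
  have hr2 : (1 - r) ^ 2 ≤ 1 - 2 * r + σ / 200 := by linarith [hrr.2]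
  have hEu : E ≤ 1 - 2 * p - 2 * q - 2 * r + p ^ 2 + σ / 20 := by
    have h1 := mul_le_mul_of_nonneg_left hr2 (sq_nonneg (1 - p - q))
    have h2 : (1 - p - q) ^ 2 * (σ / 200) ≤ 1 * (σ / 200) :=
      mul_le_mul_of_nonneg_right (pow_le_one₀ ho ho1) (by linarith)
    rw [hE]
    linarith [hpr.2, hqr.2, mul_nonneg hr (sq_nonneg (p + q))]
  have hEl : 99 / 100 ≤ E := by
    rw [hE]
    have h1 : 1 - 1 / 250 ≤ (1 - r) ^ 2 := by linarith [hrr.1]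
    exact le_trans (by norm_num) (mul_le_mul ho2l h1 (by norm_num) (sq_nonneg _))
  have hE1 : E ≤ 1 := by
    rw [hE]
    exact mul_le_one₀ (pow_le_one₀ ho ho1) (sq_nonneg _)
      (pow_le_one₀ (by linarith) (by linarith))
  have hSE : S * E ≤ 1 - 57 / 20 * q - 3 * r - 6 * p ^ 2 + σ / 8 := by
    have h1 := mul_le_mul_of_nonneg_right hSu hE0
    have h2 := mul_le_mul_of_nonneg_left hEu (show 0 ≤ 1 + 2 * p by linarith)
    have h3 : 99 / 100 * (17 / 20 * q + r + 3 * p ^ 2) ≤ E * (17 / 20 * q + r + 3 * p ^ 2) :=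
      mul_le_mul_of_nonneg_right hEl (by linarith)
    linarith [hpq.1, hpr.1, hppp.2, mul_le_mul_of_nonneg_right hp' hσ0]
  have hSE0 : 0 ≤ S * E := mul_nonneg hS0 hE0
  have hSE1 : S * E ≤ 1001 / 1000 := by linarith
  have hBE : B * p * E ≤ p - 4 * p ^ 2 + σ / 30 := by
    have h1 := mul_le_mul_of_nonneg_left hEu (mul_nonneg hB0 hp)
    have h2 : B * p * (σ / 20) ≤ 1 / 1000 * (σ / 20) :=
      mul_le_mul_of_nonneg_right ((mul_le_of_le_one_left hp hB1).trans hp') (by linarith)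
    have h3 : B * p * (1 - 2 * p + p ^ 2) ≤ p - 4 * p ^ 2 + 8 * p ^ 3 := by
      rw [hB]
      linarith [mul_nonneg (pow_nonneg hp 4) (show 0 ≤ 8 - 3 * p by linarith)]
    linarith only [h1, h2, h3, mul_nonneg (mul_nonneg hB0 hp) hq,
      mul_nonneg (mul_nonneg hB0 hp) hr, hppp.2, hσ0]
  have hBEl : 98 / 100 * p ≤ B * p * E := by
    have h1 : 997 / 1000 ≤ B := by rw [hB]; linarith
    have h2 : 98 / 100 ≤ B * E :=
      le_trans (by norm_num) (mul_le_mul h1 hEl (by norm_num) hB0)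
    linarith [mul_le_mul_of_nonneg_right h2 hp]
  have hf : 0 ≤ (1 - p - q) ^ 3 * (1 - r) ^ 3 ∧ (1 - p - q) ^ 3 * (1 - r) ^ 3 ≤ 1 := by
    have : (1 - p - q) ^ 3 * (1 - r) ^ 3 = ((1 - p - q) * (1 - r)) ^ 3 := by ring
    rw [this]
    have h0 : 0 ≤ (1 - p - q) * (1 - r) := mul_nonneg ho (by linarith)
    exact ⟨by positivity, pow_le_one₀ h0 (mul_le_one₀ ho1 (by linarith) (by linarith))⟩
  -- In `DD`, `1 - M` is at least `q - p²`; the choice of `g` adds about `3/2 p²`, which leaves room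
  -- for `x = 9/20 r`. The value of `y` makes `LDD` an equality, and `z` is the sum of the two
  -- losses it must dominate.
  refine ⟨A, B, 3 / 2 * p, 9 / 20 * r, S * E * r + 3 * p * p * E - 9 / 20 * r,
    B * r * ((1 - p - q) ^ 3 * (1 - r) ^ 3) + B * p * E * r + S * E * r ^ 2, ?_⟩
  have hrS : 98 / 100 * r ≤ S * E * r := by
    have h1 : 99 / 100 ≤ S := by
      rw [hS, hA]
      linarith only [mul_nonneg hB0 hL₁0, hp, hq', hr1, hp2', hp']
    exact mul_le_mul_of_nonneg_right
      (le_trans (by norm_num) (mul_le_mul h1 hEl (by norm_num) hS0)) hr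
  have hEl' : 1 - 2 * p - 2 * q - 2 * r ≤ E := by
    have h1 : 1 - 2 * p - 2 * q ≤ (1 - p - q) ^ 2 := by linarith only [sq_nonneg (p + q)]
    have h2 : 1 - 2 * r ≤ (1 - r) ^ 2 := by linarith only [sq_nonneg r]
    have h3 := mul_le_mul h1 h2 (by linarith only [hr1]) (sq_nonneg (1 - p - q))
    rw [hE]
    linarith only [h3, hpr.1, hqr.1]
  have hBEl' : p - 4 * p ^ 2 - 2 * (p * q) - 2 * (p * r) ≤ B * p * E := by
    have h1 := mul_le_mul_of_nonneg_left hEl' (mul_nonneg hB0 hp)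
    have h2 : p * (1 - 2 * p) ≤ B * p := by
      rw [hB]
      linarith only [hppp.1]
    have h3 := mul_le_mul_of_nonneg_right h2
      (show 0 ≤ 1 - 2 * p - 2 * q - 2 * r by linarith only [hp', hq', hr1])
    linarith only [h1, h3, hppp.1, mul_nonneg hp hpq.1, mul_nonneg hp hpr.1]
  have hMl : 998 / 1000 ≤ M := by
    have h1 : 1 - p - q ≤ M := hM ▸ le_mul_of_one_le_right ho (by linarith only [mul_nonneg hp hS0])
    linarith only [h1, hp', hq']
  have hrMl : r * (998 / 1000) ≤ r * M := mul_le_mul_of_nonneg_left hMl hr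
  have hrS' : S * E * r ≤ 1001 / 1000 * r := mul_le_mul_of_nonneg_right hSE1 hr
  have hrrS : S * E * r ^ 2 ≤ 1001 / 1000 * r ^ 2 :=
    mul_le_mul_of_nonneg_right hSE1 (sq_nonneg r)
  have hppE : 3 * p * p * E ≤ 3 * p * p := mul_le_of_le_one_right (by positivity) hE1
  have hppE' : 3 * p * p * (99 / 100) ≤ 3 * p * p * E :=
    mul_le_mul_of_nonneg_left hEl (by positivity)
  have hBrf : B * r * ((1 - p - q) ^ 3 * (1 - r) ^ 3) ≤ r :=
    mul_le_of_le_one_right hr hf.2 |>.trans' <|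
      mul_le_mul_of_nonneg_right (mul_le_of_le_one_left hr hB1) hf.1
  have hBrf0 : 0 ≤ B * r * ((1 - p - q) ^ 3 * (1 - r) ^ 3) :=
    mul_nonneg (mul_nonneg hB0 hr) hf.1
  have hBpE0 : 0 ≤ B * p * E := by positivity
  have hBpEr : B * p * E * r ≤ p * r := mul_le_mul_of_nonneg_right
    ((mul_le_of_le_one_right (mul_nonneg hB0 hp) hE1).trans (mul_le_of_le_one_left hp hB1)) hr
  have hBpEr0 : 0 ≤ B * p * E * r := by positivity
  have hrrS0 : 0 ≤ S * E * r ^ 2 := by positivity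
  have hrM : r * M ≤ r * (1001 / 1000) := mul_le_mul_of_nonneg_left hM1 hr
  have hrrM : 0 ≤ r ^ 2 * M := by positivity
  have eU : (1 - p - q) * (1 - r) * (1 + r) * (1 + p * S) = M - r ^ 2 * M := by rw [hM]; ring
  have eV : (1 - p - q) * (1 - r) ^ 2 * (1 + p * S) = M - 2 * (r * M) + r ^ 2 * M := by
    rw [hM]; ring
  refine
    { B_nonneg := hB0
      C_nonneg := le_rfl
      g_nonneg := by linarith only [hp]
      S_nonneg := by rwa [← hL₁, ← hS]
      WD := ?_
      DWD := ?_
      LWD := ?_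
      DD := ?_
      WDD := by linarith only [hr]
      y_nonneg := by linarith only [hrS, hppE', hp2, hr]
      LDD := by
        rw [← hL₁, ← hS, ← hE]
        linarith only
      LDW := by linarith only [hrS, hppE', hp2, hr]
      z_nonneg := by linarith only [hBrf0, hBpEr0, hrrS0]
      WWLD := by
        rw [← hE]
        linarith only [hrrS0]
      LLD := by
        rw [← hL₁, ← hS, ← hE]
        linarith only [hBrf0, hBpEr0]
      LD := ?_ }
  · rw [← hL₁, ← hS, ← hE, ← hσ, eU, eV, hA]
    linarith only [hMu, hrMl, hBE, hBpEr, hpr.2, hr', hσ, hq, hp2, hrσ]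
  · rw [← hE]
    linarith only [hBEl, hBpEr0, hp]
  · rw [← hL₁, ← hS, ← hE]
    linarith only [hSE, hBEl', hBpEr0, hB, hpq.2, hpr.2, hσ, hq, hr, hp2]
  · rw [← hL₁, ← hS, ← hE, ← hσ, eU]
    linarith only [hMu, hrrM, hppE', hr', hσ, hq, hp2]
  · rw [← hL₁, ← hS, ← hE, ← hσ, eU, eV]
    linarith only [hrM, hrrM, hSE, hrS', hrrS, hppE, hBrf, hBpEr, hpr.2, hrr.2, hr', hσ, hq, hp2,
      hrσ, hσ0]

/-- Admissible coefficients for the bond game with `r' = s'`, at distance from `0`. -/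
theorem isAdmissible_diagonal {s : ℝ} (hs : 1 / 10 ≤ s) (hs' : s ≤ 1 / 2) :
    ∃ A B y z, IsAdmissible (2 * s - s ^ 2) 0 (s / (1 - s)) A B 0 0 (1 / 100) 0 y z := by
  have hs1 : 0 < 1 - s := by linarith
  obtain ⟨v, hv⟩ : ∃ v, v = 1 - 2 * s := ⟨_, rfl⟩
  have hv0 : 0 ≤ v := by linarith
  have hv1 : v ≤ 4 / 5 := by linarith
  obtain ⟨m, hm⟩ : ∃ m, m = s * (1 - s) := ⟨_, rfl⟩
  have hm0 : 0 ≤ m := hm ▸ mul_nonneg (by linarith) hs1.le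
  have hm1 : m ≤ 1 / 4 := by rw [hm]; linarith [sq_nonneg (s - 1 / 2)]
  have hvm : v ^ 2 * m ≤ 1 / 16 := by
    have : v ^ 2 = 1 - 4 * m := by rw [hv, hm]; ring
    rw [this]; linarith [sq_nonneg (m - 1 / 8)]
  have hvm0 : 0 ≤ v ^ 2 * m := mul_nonneg (sq_nonneg v) hm0
  obtain ⟨S, hS⟩ : ∃ S, S = v * (1 + v ^ 2 * m) := ⟨_, rfl⟩
  -- The choice `A = v` equals the factor `(1 - p)(1 - r²)`, while `(1 - p)(1 - r)²` is `v²`. The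
  -- main part of `WD` therefore factors as `(1 + v)(1 - v (1 + p S))`, and `1 - v (1 + p S)` is `s
  -- * k`.
  have hS0 : 0 ≤ S := hS ▸ mul_nonneg hv0 (by linarith)
  have eo : 1 - (2 * s - s ^ 2) - 0 = (1 - s) ^ 2 := by ring
  have eor : (1 - s) ^ 2 * (s / (1 - s)) = m := by rw [hm]; field_simp
  have eS : v + v ^ 3 * (0 + (1 - (2 * s - s ^ 2) - 0) * (s / (1 - s))) = S := by
    rw [eo, eor, hS]; ring
  have eU : (1 - (2 * s - s ^ 2) - 0) * (1 - s / (1 - s)) * (1 + s / (1 - s)) = v := by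
    rw [eo, hv]; field_simp; ring
  have eV : (1 - (2 * s - s ^ 2) - 0) * (1 - s / (1 - s)) ^ 2 = v ^ 2 := by
    rw [eo, hv]; field_simp; ring
  have eE : (1 - (2 * s - s ^ 2) - 0) ^ 2 * (1 - s / (1 - s)) ^ 2 = (1 - s) ^ 2 * v ^ 2 := by
    rw [eo, hv]; field_simp; ring
  have eF : (1 - (2 * s - s ^ 2) - 0) ^ 3 * (1 - s / (1 - s)) ^ 3 = (1 - s) ^ 3 * v ^ 3 := by
    rw [eo, hv]; field_simp; ring
  have er : (1 - s) * (s / (1 - s)) = s := by field_simp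
  have hs2 : (1 - s) ^ 2 ≤ 81 / 100 := by
    have := pow_le_pow_left₀ hs1.le (show 1 - s ≤ 9 / 10 by linarith) 2
    linarith
  have hv2 : v ^ 2 ≤ 4 / 5 * v := by rw [sq]; exact mul_le_mul_of_nonneg_right hv1 hv0
  have hv2' : v ^ 2 ≤ 16 / 25 := by linarith
  obtain ⟨k, hk⟩ : ∃ k, k = 2 - v ^ 2 * (2 - s) * (1 + v ^ 2 * m) := ⟨_, rfl⟩
  have hk' : 7 / 10 ≤ k := by
    have h1 : v ^ 2 * (2 - s) ≤ 16 / 25 * (19 / 10) :=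
      mul_le_mul hv2' (by linarith) (by linarith) (by norm_num)
    have h2 : v ^ 2 * (2 - s) * (1 + v ^ 2 * m) ≤ 16 / 25 * (19 / 10) * (17 / 16) :=
      mul_le_mul h1 (by linarith) (by linarith) (by norm_num)
    rw [hk]
    linarith
  have ek : 1 - v * (1 + (2 * s - s ^ 2) * S) = s * k := by rw [hk, hS, hv]; ring
  have hsk : 7 / 100 ≤ s * k :=
    le_trans (by norm_num) (mul_le_mul hs hk' (by norm_num) (by linarith))
  have hp : 0 ≤ 2 * s - s ^ 2 := by
    have : 0 ≤ s * (2 - s) := mul_nonneg (by linarith) (by linarith)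
    linarith
  have hp1 : 2 * s - s ^ 2 ≤ 1 := by linarith [sq_nonneg (1 - s)]
  have hρ0 : 0 ≤ s / (1 - s) := div_nonneg (by linarith) hs1.le
  generalize s / (1 - s) = ρ at eor eS eU eV eE eF er hρ0 ⊢
  have hE0 : 0 ≤ (1 - s) ^ 2 * v ^ 2 := by positivity
  refine ⟨v, v ^ 3, S * ((1 - s) ^ 2 * v ^ 2) * ρ, v ^ 3 * ρ * ((1 - s) ^ 3 * v ^ 3) +
    v ^ 3 * (2 * s - s ^ 2) * ((1 - s) ^ 2 * v ^ 2) * ρ + S * ((1 - s) ^ 2 * v ^ 2) * ρ ^ 2, ?_⟩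
  have z₁ : 0 ≤ v ^ 3 * ρ * ((1 - s) ^ 3 * v ^ 3) := by positivity
  have z₂ : 0 ≤ v ^ 3 * (2 * s - s ^ 2) * ((1 - s) ^ 2 * v ^ 2) * ρ := by positivity
  have z₃ : 0 ≤ S * ((1 - s) ^ 2 * v ^ 2) * ρ ^ 2 := by positivity
  refine
    { B_nonneg := by positivity
      C_nonneg := le_rfl
      g_nonneg := le_rfl
      S_nonneg := by rwa [eS]
      WD := ?_
      DWD := by rw [eE]; positivity
      LWD := ?_
      DD := ?_
      WDD := by linarith
      y_nonneg := by positivity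
      LDD := by rw [eS, eE]; linarith
      LDW := by rw [eE]; linarith [show 0 ≤ S * ((1 - s) ^ 2 * v ^ 2) * ρ by positivity]
      z_nonneg := by linarith
      WWLD := by rw [eE, eF]; linarith
      LLD := by rw [eS, eE]; linarith
      LD := ?_ }
  · rw [eS, eU, eV, eE, ek]
    have e : 1 * (s * k) + v - v ^ 2 * (1 + (2 * s - s ^ 2) * S) -
        (2 + ρ) * v ^ 3 * (2 * s - s ^ 2) * ((1 - s) ^ 2 * v ^ 2) =
        s * ((1 + v) * k - v * (v ^ 2) ^ 2 * ((2 - s) ^ 2 * (1 - s))) := by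
      linear_combination v * ek -
        v ^ 3 * (2 * s - s ^ 2) * (1 - s) * v ^ 2 * er
    have h1 : (1 + v) * (7 / 10) ≤ (1 + v) * k := mul_le_mul_of_nonneg_left hk' (by linarith)
    have h2 : (v ^ 2) ^ 2 ≤ (16 / 25) ^ 2 := pow_le_pow_left₀ (sq_nonneg v) hv2' 2
    have h3 : (2 - s) ^ 2 * (1 - s) ≤ (19 / 10) ^ 2 * (9 / 10) :=
      mul_le_mul (pow_le_pow_left₀ (by linarith) (by linarith) 2) (by linarith) hs1.le
        (by norm_num)
    have h4 : v * (v ^ 2) ^ 2 * ((2 - s) ^ 2 * (1 - s)) ≤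
        v * (16 / 25) ^ 2 * ((19 / 10) ^ 2 * (9 / 10)) :=
      mul_le_mul (mul_le_mul_of_nonneg_left h2 hv0) h3 (by positivity) (by positivity)
    have h5 : 1 / 10 * (1 / 10) ≤
        s * ((1 + v) * k - v * (v ^ 2) ^ 2 * ((2 - s) ^ 2 * (1 - s))) :=
      mul_le_mul hs (by linarith) (by norm_num) (by linarith)
    linarith
  · rw [eS, eE, hS]
    have h1 : (1 + v ^ 2 * m) * (1 - s) ^ 2 ≤ 1 :=
      (mul_le_mul (show 1 + v ^ 2 * m ≤ 17 / 16 by linarith) hs2 (sq_nonneg _)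
        (by norm_num)).trans (by norm_num)
    have h2 := mul_le_mul_of_nonneg_left h1 (pow_nonneg hv0 3)
    have h3 : 0 ≤ (2 + ρ) * v ^ 3 * (2 * s - s ^ 2) * ((1 - s) ^ 2 * v ^ 2) := by positivity
    linarith
  · rw [eS, eU, eE, ek]
    linarith
  · rw [eS, eU, eV, eE, ek]
    have hSu : S ≤ 17 / 20 := by
      rw [hS]
      exact (mul_le_mul hv1 (show 1 + v ^ 2 * m ≤ 17 / 16 by linarith) (by linarith)
        (by norm_num)).trans (by norm_num)
    have e : v ^ 2 * (1 + (2 * s - s ^ 2) * S) - S * ((1 - s) ^ 2 * v ^ 2) * (1 + ρ) -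
        S * ((1 - s) ^ 2 * v ^ 2) * ρ - (v ^ 3 * ρ * ((1 - s) ^ 3 * v ^ 3) +
        v ^ 3 * (2 * s - s ^ 2) * ((1 - s) ^ 2 * v ^ 2) * ρ +
        S * ((1 - s) ^ 2 * v ^ 2) * ρ ^ 2) =
        v ^ 2 * (1 - S + (2 * s - s ^ 2) * S - v ^ 2 * (v ^ 2 * m) * (1 - s) -
          v * (v ^ 2 * m) * (2 * s - s ^ 2)) := by
      rw [hm]
      linear_combination (-2 * S * (1 - s) * v ^ 2 - v ^ 6 * (1 - s) ^ 2 -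
        v ^ 5 * (2 * s - s ^ 2) * (1 - s) - S * v ^ 2 * ((1 - s) * ρ + s)) * er
    have h1 : v ^ 2 * (v ^ 2 * m) * (1 - s) ≤ 16 / 25 * (1 / 16) * 1 :=
      mul_le_mul (mul_le_mul hv2' hvm hvm0 (by norm_num)) (by linarith) hs1.le (by norm_num)
    have h2 : v * (v ^ 2 * m) * (2 * s - s ^ 2) ≤ 4 / 5 * (1 / 16) * 1 :=
      mul_le_mul (mul_le_mul hv1 hvm hvm0 (by norm_num)) hp1 hp (by norm_num)
    have h3 := mul_nonneg (sq_nonneg v) (show 0 ≤ 1 - S + (2 * s - s ^ 2) * S -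
      v ^ 2 * (v ^ 2 * m) * (1 - s) - v * (v ^ 2 * m) * (2 * s - s ^ 2) by
        linarith [mul_nonneg hp hS0])
    linarith

/-- Admissible coefficients for `p = q = 0` and `r` large. -/
theorem isAdmissible_of_large {r : ℝ} (hr : 3 / 10 ≤ r) (hr' : r ≤ 1) :
    ∃ A B y z, IsAdmissible 0 0 r A B 0 0 (1 / 50) 0 y z := by
  obtain ⟨u, hu⟩ : ∃ u, u = 1 - r := ⟨_, rfl⟩
  have hr0 : 0 ≤ r := by linarith
  have hu0 : 0 ≤ u := by linarith
  have hu1 : u ≤ 7 / 10 := by linarith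
  have eu : u * (1 + r) = 1 - r ^ 2 := by rw [hu]; ring
  have hur0 : 0 ≤ u ^ 2 * r := by positivity
  -- The maximum of `r (1 - r)²` is attained at `r = 1/3`. With `B = 6/5 u⁴` it gives `S ≤ 53/45
  -- u²`, and `53/45 < 6/5` yields `LWD`.
  have hur : u ^ 2 * r ≤ 4 / 27 := by
    have : 0 ≤ (r - 1 / 3) ^ 2 * (4 / 3 - r) := mul_nonneg (sq_nonneg _) (by linarith)
    rw [hu]
    linarith
  have hu2 : u ^ 2 ≤ (7 / 10) ^ 2 := pow_le_pow_left₀ hu0 hu1 2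
  have hu3 : u ^ 3 ≤ (7 / 10) ^ 3 := pow_le_pow_left₀ hu0 hu1 3
  have hr2 : (3 / 10) ^ 2 ≤ r ^ 2 := pow_le_pow_left₀ (by norm_num) hr 2
  have hr2' : r ^ 2 ≤ 1 := pow_le_one₀ hr0 hr'
  obtain ⟨S, hS⟩ : ∃ S, S = u ^ 2 + 6 / 5 * u ^ 4 * r := ⟨_, rfl⟩
  have hS0 : 0 ≤ S := by rw [hS]; positivity
  have hSu : S ≤ 53 / 45 * u ^ 2 := by
    rw [hS]
    linarith [mul_le_mul_of_nonneg_left hur (sq_nonneg u)]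
  have eS : u ^ 2 + 6 / 5 * u ^ 4 * (0 + (1 - 0 - 0) * r) = S := by rw [hS]; ring
  have hB : 0 ≤ 6 / 5 * u ^ 4 * r * u ^ 3 := by positivity
  have hL : 0 ≤ S * u ^ 2 * r ^ 2 := by positivity
  have hL' : 0 ≤ S * u ^ 2 * r := by positivity
  refine ⟨u ^ 2, 6 / 5 * u ^ 4, S * u ^ 2 * r, 6 / 5 * u ^ 4 * r * u ^ 3 + S * u ^ 2 * r ^ 2, ?_⟩
  refine
    { B_nonneg := by positivity
      C_nonneg := le_rfl
      g_nonneg := le_rfl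
      S_nonneg := by rwa [eS]
      WD := ?_
      DWD := by linarith
      LWD := ?_
      DD := by linarith
      WDD := by linarith
      y_nonneg := hL'
      LDD := by rw [eS, ← hu]; linarith
      LDW := by linarith
      z_nonneg := by linarith
      WWLD := by rw [← hu]; linarith
      LLD := by rw [eS, ← hu]; linarith
      LD := ?_ }
  · rw [← hu]
    linarith
  · rw [eS, ← hu]
    linarith [mul_le_mul_of_nonneg_right hSu (sq_nonneg u), pow_nonneg hu0 4]
  · rw [eS, ← hu]
    have e : S * u ^ 2 * (1 + r) + S * u ^ 2 * r + S * u ^ 2 * r ^ 2 = S * (1 - r ^ 2) ^ 2 := by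
      rw [hu]; ring
    have h1 := mul_le_mul_of_nonneg_right hSu (sq_nonneg (1 - r ^ 2))
    have h2 : (1 - r ^ 2) ^ 2 ≤ 1 - (3 / 10) ^ 2 := by
      linarith [mul_nonneg (sq_nonneg r) (sub_nonneg.2 hr2')]
    have h3 := mul_le_mul_of_nonneg_left h2 (show 0 ≤ 53 / 45 * u ^ 2 by positivity)
    have h4 : 6 / 5 * u ^ 2 * (u ^ 3 * (u ^ 2 * r)) ≤
        6 / 5 * u ^ 2 * ((7 / 10) ^ 3 * (4 / 27)) :=
      mul_le_mul_of_nonneg_left (mul_le_mul hu3 hur hur0 (by norm_num)) (by positivity)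
    linarith

/-- Admissible coefficients for `p = q = 0` and `r` moderate. -/
theorem isAdmissible_of_moderate {r : ℝ} (hr : 39 / 250 ≤ r) (hr' : r ≤ 3 / 10) :
    ∃ A B C x y z, IsAdmissible 0 0 r A B C 0 (1 / 1000) x y z := by
  obtain ⟨u, hu⟩ : ∃ u, u = 1 - r := ⟨_, rfl⟩
  have hr0 : 0 ≤ r := by linarith
  have hu0 : 7 / 10 ≤ u := by linarith
  have hu1 : u ≤ 1 := by linarith
  have hu2 : (7 / 10) ^ 2 ≤ u ^ 2 := pow_le_pow_left₀ (by norm_num) hu0 2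
  have hu2' : u ^ 2 ≤ 1 := pow_le_one₀ (by linarith) hu1
  have hu3 : (7 / 10) ^ 3 ≤ u ^ 3 := pow_le_pow_left₀ (by norm_num) hu0 3
  have hr2 : r ^ 2 ≤ (3 / 10) ^ 2 := pow_le_pow_left₀ hr0 hr' 2
  obtain ⟨N, hN⟩ : ∃ N, N = 1 - r * u ^ 2 := ⟨_, rfl⟩
  have hN0 : 0 < N := by
    have := mul_le_mul hr' hu2' (sq_nonneg u) (by norm_num)
    linarith
  -- With `C = 7/20`, this `A` leaves exactly `1/500` in the left-hand balance of `WD`, and `B`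
  -- below solves `LWD` with equality. A positive `C` permits a smaller `A`, at a cost in `DD`,
  -- where `r² (7/10 r - 1/20)` remains.
  obtain ⟨A, hA⟩ : ∃ A, A = 13 / 20 * u ^ 2 - r ^ 2 + 1 / 500 := ⟨_, rfl⟩
  have hA0 : 0 ≤ A := by rw [hA]; linarith
  obtain ⟨B, hB⟩ : ∃ B, B = A * u ^ 2 / N := ⟨_, rfl⟩
  have hB0 : 0 ≤ B := by rw [hB]; positivity
  have hBN : B * N = A * u ^ 2 := by rw [hB]; field_simp
  have eE : (1 - 0 - 0) ^ 2 * (1 - r) ^ 2 = u ^ 2 := by rw [hu]; ring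
  have eF : (1 - 0 - 0) ^ 3 * (1 - r) ^ 3 = u ^ 3 := by rw [hu]; ring
  have eS : (A + B * (0 + (1 - 0 - 0) * r)) * u ^ 2 = B := by
    rw [hN] at hBN
    linear_combination -hBN
  have hBr : 0 ≤ B * r := mul_nonneg hB0 hr0
  have hLDW : 0 ≤ 7 / 20 * u ^ 2 * (2 * r * (1 - r)) := by
    have : 0 ≤ 1 - r := by linarith
    positivity
  refine ⟨A, B, 7 / 20, 7 / 20 * u ^ 2 * r ^ 2, B * r + 7 / 20 * u ^ 2 * (1 - 2 * r ^ 2),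
    B * r * u ^ 3, ?_⟩
  refine
    { B_nonneg := hB0
      C_nonneg := by norm_num
      g_nonneg := le_rfl
      S_nonneg := by linarith
      WD := ?_
      DWD := by rw [eE]; linarith
      LWD := by rw [eE, eS]; linarith
      DD := ?_
      WDD := by rw [eE]
      y_nonneg := by
        have : 0 ≤ 1 - 2 * r ^ 2 := by linarith
        positivity
      LDD := by rw [eE, eS]; linarith
      LDW := by rw [eE]; linarith
      z_nonneg := by positivity
      WWLD := by rw [eE, eF]; linarith
      LLD := by
        rw [eE, eS]
        linarith [mul_le_mul_of_nonneg_left (show r ≤ u ^ 3 by linarith) hBr]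
      LD := ?_ }
  · rw [eE, hA, hu]
    linarith
  · rw [eE, hu]
    have h1 : (39 / 250) ^ 2 * (-(1 / 20) + 7 / 10 * (39 / 250)) ≤
        r ^ 2 * (-(1 / 20) + 7 / 10 * r) :=
      mul_le_mul (pow_le_pow_left₀ (by norm_num) hr 2) (by linarith) (by norm_num) (sq_nonneg r)
    linarith
  · rw [eE, eS]
    have key : A * u ^ 2 * (1 + 2 * r + r * u ^ 3) ≤
        (r ^ 2 + u ^ 2 * (13 / 20 + 7 / 10 * r ^ 2) - 1 / 1000) * N := by
      -- This polynomial inequality has little room at `r = 39/250`. Recentred there, it follows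
      -- from the positivity of powers of `t` and of `1/6 - t`.
      obtain ⟨t, ht⟩ : ∃ t, r = t + 39 / 250 := ⟨r - 39 / 250, by ring⟩
      have ht0 : 0 ≤ t := by linarith
      have ht1 : 0 ≤ 1 / 6 - t := by linarith
      have pos : ∀ n : ℕ, 0 ≤ t ^ n * (1 / 6 - t) := fun n => mul_nonneg (pow_nonneg ht0 n) ht1
      rw [hA, hN, hu, ht]
      linarith [pos 2, pos 4, pos 6, pos 7, pow_nonneg ht0 2, pow_nonneg ht0 4,
        pow_nonneg ht0 6]
    have h1 : B * (1 + 2 * r + r * u ^ 3) ≤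
        r ^ 2 + u ^ 2 * (13 / 20 + 7 / 10 * r ^ 2) - 1 / 1000 := by
      rw [hB, div_mul_eq_mul_div, div_le_iff₀ hN0]
      exact key
    rw [hu] at *
    linarith

/-! ### The bond game as a generalized game, and the hypotheses near the origin. -/

theorem mem_Theta_of_mem_Theta' {r s : ℝ} (h : (r, s) ∈ Theta') :
    (2 * s - s ^ 2, 0, r / (1 - s)) ∈ Theta := by
  obtain ⟨⟨hr, hr'⟩, ⟨hs, hs'⟩, h0, h1⟩ := h
  simp only at hr hr' hs hs' h0 h1
  have hp : 0 ≤ s * (2 - s) := mul_nonneg hs (by linarith)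
  refine ⟨⟨by simp only; linarith, by simp only; linarith [sq_nonneg (1 - s)]⟩,
    ⟨le_rfl, zero_le_one⟩, ⟨div_nonneg hr (by linarith), div_le_one_of_le₀ (by linarith)
      (by linarith)⟩, ?_, by simp only; linarith [sq_nonneg (1 - s)]⟩
  simp only
  rcases hs.eq_or_lt with rfl | hs
  · norm_num
    linarith
  · have : 0 < s * (2 - s) := mul_pos hs (by linarith)
    have : 0 ≤ r / (1 - s) := div_nonneg hr (by linarith)
    linarith

/-- The bond game is a particular case of the generalized percolation game. -/
theorem gMatrix_eq_eMatrix {r s : ℝ} (h : (r, s) ∈ Theta') :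
    gMatrix (2 * s - s ^ 2) 0 (r / (1 - s)) = eMatrix r s := by
  obtain ⟨⟨hr, hr'⟩, ⟨hs, hs'⟩, h0, h1⟩ := h
  simp only at hr hr' hs hs' h0 h1
  have e : (1 - s) * (r / (1 - s)) = r := by
    rcases hs'.eq_or_lt with rfl | hs'
    -- At `s = 1` division by zero gives `0`, which is harmless because then `r = 0`.
    · have : r = 0 := by linarith
      simp [this]
    · have : 1 - s ≠ 0 := by linarith
      field_simp
  generalize r / (1 - s) = ρ at e
  subst e
  funext a b c
  cases a <;> cases b <;> cases c <;> simp only [gMatrix, eMatrix] <;> ring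

/-- In the bond game each edge independently forces a win with probability `s`, is blocked with
probability `r`, and is open otherwise. Some edge forces a win with probability `2s - s²`; given
that none does, each is blocked with probability `r / (1 - s)`. -/
theorem isErgodic_bond_of_isAdmissible {r s A B C g κ x y z : ℝ} (h : (r, s) ∈ Theta')
    (hκ : 0 < κ) (hc : IsAdmissible (2 * s - s ^ 2) 0 (r / (1 - s)) A B C g κ x y z) :
    (E r s h).IsErgodic ∧ (EHat r s h).IsErgodic := by
  have hG : G _ _ _ (mem_Theta_of_mem_Theta' h) = E r s h := by
    simp only [G, E, gMatrix_eq_eMatrix h]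
  have hGHat : GHat _ _ _ (mem_Theta_of_mem_Theta' h) = EHat r s h := by
    simp only [GHat, EHat, gMatrix_eq_eMatrix h]
  rw [← hG, ← hGHat]
  exact isErgodic_of_isAdmissible _ hκ hc

/-- The conditions on the generalized game, near the origin, bound `r` by `q` and `p ^ 2`. -/
theorem le_of_conditions {p q r : ℝ} (hp : 0 ≤ p) (hq : 0 ≤ q) (hr : 0 ≤ r)
    (hp' : p ≤ 1 / 1000) (hq' : q ≤ 1 / 1000) (hr' : r ≤ 1 / 1000) (hU : CondUniversal p q r)
    (hC : CondOne p q r ∨ CondTwo p q r ∨ CondThree p q r ∨ CondFour p q r) :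
    r ≤ 17 / 10 * q + 4 / 5 * p ^ 2 := by
  have bound : ∀ a b : ℝ, 0 ≤ a → a ≤ 1 / 1000 → 0 ≤ b → 0 ≤ a * b ∧ a * b ≤ 1 / 1000 * b :=
    fun a b ha ha' hb => ⟨mul_nonneg ha hb, mul_le_mul_of_nonneg_right ha' hb⟩
  have hpp := bound p p hp hp' hp
  have hpq := bound p q hp hp' hq
  have hpr := bound p r hp hp' hr
  have hqq := bound q q hq hq' hq
  have hqr := bound q r hq hq' hr
  have hrr := bound r r hr hr' hr
  have hrq := bound r q hr hr' hq
  have hqp := bound q p hq hq' hp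
  have hrp := bound r p hr hr' hp
  -- To first order in `p`, `q`, `r`: (a) `p ≤ q` and `2r ≤ p + q` give `r ≤ q`; (b) `p ≤ 2q` gives
  -- `r ≤ 3/2 q`; (c) `p ≤ q + r` and `4r ≤ p + 4q` give `r ≤ 5/3 q`, the source of `17/10`; (d)
  -- gives `r ≤ 3/2 q + p²/4`.
  rcases hC with h | ⟨-, h, h'⟩ | ⟨-, h, -, h'⟩ | ⟨-, h⟩
  · unfold CondOne at h
    unfold CondUniversal at hU
    have h1 : q * (1 - q - r * (1 - p - q)) ≤ q := mul_le_of_le_one_right hq (by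
      linarith [mul_nonneg hr (show 0 ≤ 1 - p - q by linarith)])
    linarith
  · unfold CondUniversal at hU
    linarith
  · have h1 : (q + r * (1 - p - q)) * (1 - q - r * (1 - p - q)) ≤ q + r * (1 - p - q) := by
      have h0 : 0 ≤ r * (1 - p - q) := mul_nonneg hr (by linarith)
      exact mul_le_of_le_one_right (by linarith) (by linarith)
    linarith
  · linarith

/-- With `p = 2s - s²` and `ρ = r / (1 - s)`, the leading terms read `2ρ ≤ 3/2 p²`, that is `ρ ≤ 3/4
p²`; the margin up to `4/5` absorbs the products `pρ` and `ρ²`. -/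
theorem le_of_condBond {r s : ℝ} (hr : 0 ≤ r) (hs : 0 ≤ s) (hr' : r ≤ 1 / 2500)
    (hs' : s ≤ 1 / 2500) (h : CondBond r s) :
    r / (1 - s) ≤ 4 / 5 * (2 * s - s ^ 2) ^ 2 := by
  have hs1 : 0 < 1 - s := by linarith
  have hp : 0 ≤ 2 * s - s ^ 2 := by
    have : 0 ≤ s * (2 - s) := mul_nonneg hs (by linarith)
    linarith
  have hp' : 2 * s - s ^ 2 ≤ 1 / 1000 := by linarith [sq_nonneg s]
  have hρ : 0 ≤ r / (1 - s) := by positivity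
  have hρ' : r / (1 - s) ≤ 1 / 1000 := by
    rw [div_le_iff₀ hs1]
    linarith
  have h' : 2 * (r / (1 - s)) ≤ 3 / 2 * (2 * s - s ^ 2) ^ 2 +
      8 * ((2 * s - s ^ 2) * (r / (1 - s))) + 11 / 2 * (r / (1 - s)) ^ 2 := by
    unfold CondBond at h
    have e₁ : 0 ≤ 9 * (2 * s - s ^ 2) ^ 3 / 2 := by positivity
    have e₂ : 0 ≤ 16 * (2 * s - s ^ 2) ^ 2 * r / (1 - s) := by positivity
    have e₃ : 0 ≤ 43 * (2 * s - s ^ 2) * r ^ 2 / (2 * (1 - s) ^ 2) := by positivity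
    have e₄ : 0 ≤ 5 * r ^ 3 / (1 - s) ^ 3 := by positivity
    have e₅ : 11 * r ^ 2 / (2 * (1 - s) ^ 2) = 11 / 2 * (r / (1 - s)) ^ 2 := by
      field_simp
    have e₆ : 8 * (2 * s - s ^ 2) * r / (1 - s) = 8 * ((2 * s - s ^ 2) * (r / (1 - s))) := by
      field_simp
    have e₇ : 2 * r / (1 - s) = 2 * (r / (1 - s)) := by ring
    linarith
  generalize r / (1 - s) = ρ at *
  generalize 2 * s - s ^ 2 = p at *
  have h1 := mul_le_mul_of_nonneg_right hp' hρ
  have h2 := mul_le_mul_of_nonneg_right hρ' hρ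
  linarith [sq_nonneg p]

theorem exists_isAdmissible_small {p q r : ℝ} (h : (p, q, r) ∈ Theta) (hp : p ≤ 1 / 1000)
    (hq : q ≤ 1 / 1000) (hr : r ≤ 17 / 10 * q + 4 / 5 * p ^ 2) :
    ∃ A B C g κ x y z, 0 < κ ∧ IsAdmissible p q r A B C g κ x y z := by
  obtain ⟨⟨hp0, -⟩, ⟨hq0, -⟩, ⟨hr0, -⟩, h0, -⟩ := h
  simp only at hp0 hq0 hr0 h0
  obtain ⟨A, B, g, x, y, z, hc⟩ := isAdmissible_small hp0 hq0 hr0 hp hq hr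
  refine ⟨A, B, 0, g, _, x, y, z, ?_, hc⟩
  -- If `p = q = 0` the bound forces `r = 0`, which `Theta` excludes.
  have : 0 < q + p ^ 2 := by
    rcases hp0.eq_or_lt with rfl | hp0
    · norm_num at hr ⊢
      linarith
    · positivity
  positivity

end PercPCA

open PercPCA

theorem theorem3 :
    (∃ ε₁ ∈ Set.Ioo (0 : ℝ) 1, ∃ ε₂ ∈ Set.Ioo (0 : ℝ) 1, ∃ ε₃ ∈ Set.Ioo (0 : ℝ) 1,
      ∀ (p q r : ℝ) (h : (p, q, r) ∈ PercPCA.Theta),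
        p ≤ ε₁ → q ≤ ε₂ → r ≤ ε₃ →
        PercPCA.CondUniversal p q r →
        (PercPCA.CondOne p q r ∨ PercPCA.CondTwo p q r ∨
          PercPCA.CondThree p q r ∨ PercPCA.CondFour p q r) →
        (PercPCA.G p q r h).IsErgodic ∧ (PercPCA.GHat p q r h).IsErgodic) ∧
    (∃ ε₁ ∈ Set.Ioo (0 : ℝ) 1, ∃ ε₂ ∈ Set.Ioo (0 : ℝ) 1,
      ∀ (r' s' : ℝ) (h : (r', s') ∈ PercPCA.Theta'),
        r' ≤ ε₁ → s' ≤ ε₂ → PercPCA.CondBond r' s' →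
        (PercPCA.E r' s' h).IsErgodic ∧ (PercPCA.EHat r' s' h).IsErgodic) ∧
    (∀ (r' s' : ℝ) (h : (r', s') ∈ PercPCA.Theta'),
        s' = 0 → (0.157175 : ℝ) < r' →
        (PercPCA.E r' s' h).IsErgodic ∧ (PercPCA.EHat r' s' h).IsErgodic) ∧
    (∀ (r' s' : ℝ) (h : (r', s') ∈ PercPCA.Theta'),
        r' = s' → (0.10883 : ℝ) ≤ r' →
        (PercPCA.E r' s' h).IsErgodic ∧ (PercPCA.EHat r' s' h).IsErgodic) := by
  refine ⟨⟨1 / 1000, by norm_num, 1 / 1000, by norm_num, 1 / 1000, by norm_num,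
    fun p q r h hp hq hr hU hC => ?_⟩, ⟨1 / 2500, by norm_num, 1 / 2500, by norm_num,
    fun r s h hr hs hC => ?_⟩, fun r s h hs hr => ?_, fun r s h hrs hr => ?_⟩
  · obtain ⟨⟨hp0, -⟩, ⟨hq0, -⟩, ⟨hr0, -⟩, -, -⟩ := id h
    obtain ⟨_, _, _, _, _, _, _, _, hκ, hc⟩ :=
      exists_isAdmissible_small h hp hq (le_of_conditions hp0 hq0 hr0 hp hq hr hU hC)
    exact isErgodic_of_isAdmissible h hκ hc
  · obtain ⟨⟨hr0, -⟩, ⟨hs0, -⟩, -, -⟩ := id h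
    obtain ⟨_, _, _, _, _, _, _, _, hκ, hc⟩ := exists_isAdmissible_small
      (mem_Theta_of_mem_Theta' h) (by linarith [sq_nonneg s]) (by norm_num)
      (by linarith [le_of_condBond hr0 hs0 hr hs hC])
    exact isErgodic_bond_of_isAdmissible h hκ hc
  · subst hs
    obtain ⟨⟨hr0, hr1⟩, -⟩ := id h
    have e₁ : 2 * (0 : ℝ) - 0 ^ 2 = 0 := by norm_num
    have e₂ : r / (1 - 0) = r := by norm_num
    -- The thresholds leave room: `0.157175 > 39/250` here, and `0.10883 > 1/10` in the diagonal
    -- case, where `2r ≤ 1` also gives `r ≤ 1/2`.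
    rcases le_total r (3 / 10) with hr' | hr'
    · obtain ⟨_, _, _, _, _, _, hc⟩ := isAdmissible_of_moderate (by linarith) hr'
      exact isErgodic_bond_of_isAdmissible h (κ := 1 / 1000) (by norm_num) (by rwa [e₁, e₂])
    · obtain ⟨_, _, _, _, hc⟩ := isAdmissible_of_large hr' hr1
      exact isErgodic_bond_of_isAdmissible h (κ := 1 / 50) (by norm_num) (by rwa [e₁, e₂])
  · subst hrs
    obtain ⟨-, -, -, h1⟩ := id h
    simp only at h1
    obtain ⟨_, _, _, _, hc⟩ := isAdmissible_diagonal (s := r) (by linarith) (by linarith)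
    exact isErgodic_bond_of_isAdmissible h (by norm_num) hc
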